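/- Let $n\ge 2$ be an integer. On $\mathbb S^n$ with normalized surface measure $dw$ ($\int_{\mathbb S^n}dw=1$) let $$P_n=\prod_{j=0}^{\frac{n-2}{2}}(-\Delta+j(n-j-1))\ (n\text{ even}),\qquad P_n=\Big(-\Delta+\big(\tfrac{n-1}{2}\big)^2\Big)^{1/2}\prod_{j=0}^{\frac{n-3}{2}}(-\Delta+j(n-j-1))\ (n\text{ odd})$$ be the Paneitz operator, defined by the functional calculus of $-\Delta$, and let $\mathcal V$ be the Hilbert space of functions $u\in H^n(\mathbb S^n)$ that depend only on $x=\xi_1\in(-1,1)$ and satisfy $\int_{\mathbb S^n}u\,dw=0$. For $\rho\in\mathbb R$ and $u\in\mathcal V$ consider the equation $$P_nu+\rho\Big(1-\frac{e^{nu}}{\int_{\mathbb S^n}e^{nu}\,dw}\Big)=0 .\tag{41}$$ Then, when $n$ is even, $u\in\mathcal V$ solves (41) if and only if $$(-1)^{\frac n2}\big[(1-x^2)^{\frac n2}u'\big]^{(n-1)}+\rho\Big(1-\frac{\sqrt\pi\,\Gamma(\frac n2)}{\Gamma(\frac{n+1}2)}\,\frac{e^{nu}}{\int_{-1}^1(1-x^2)^{\frac{n-2}2}e^{nu}\,dx}\Big)=0$$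 in the sense of distributions on $(-1,1)$. Moreover $(\rho,0)$ solves (41) for every $\rho\in\mathbb R$; call a solution $(\rho,u)$ with $u\ne0$ nontrivial. For $k\ge1$ let $\lambda_k=\prod_{s=0}^{n-1}(k+s)$, $\rho_k=\lambda_k/n$, and let $C_k=C_k^{\frac{n-1}2}(x)$ be the Gegenbauer polynomial of order $\frac{n-1}2$ and degree $k$. For every $k\ge1$ the function $C_k$ belongs to $\mathcal V$, and $(\rho_k,0)$ is a bifurcation point for the curve of solutions $(\rho,0)$, i.e. it lies in the closure in $\mathbb R\times\mathcal V$ of the set of nontrivial solutions of (41). Moreover there are $\varepsilon_0>0$ and continuously differentiable functions $\rho_k(\cdot):(-\varepsilon_0,\varepsilon_0)\to\mathbb R$ and $\psi_k:(-\varepsilon_0,\varepsilon_0)\to\mathcal V$, with $\int_{-1}^1(1-x^2)^{\frac{n-2}2}\psi_k(\varepsilon)C_k\,dx=0$ for all $\varepsilon$, $\rho_k(0)=\rho_k$ and $\psi_k(0)=0$, and an open neighborhood $U$ of $(\rho_k,0)$ in $\mathbb R\times\mathcal V$, such that the nontrivial solutions of (41) in $U$ are exactly the pairs $$(\rho_k(\varepsilon),\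 \varepsilon C_k+\varepsilon\psi_k(\varepsilon)),\qquad 0<|\varepsilon|<\varepsilon_0 .$$ For $k=2$ we have $\rho_2=\frac{(n+1)!}{n}$, the bifurcation is transcritical ($\rho_2(\varepsilon)-\rho_2$ and $\rho_2(-\varepsilon)-\rho_2$ are nonzero and of opposite signs for small $\varepsilon>0$), and $$\rho_2'(0)=-\frac{(n+1)!}{2}\,\frac{\int_{-1}^1(1-x^2)^{\frac{n-2}2}C_2^3\,dx}{\int_{-1}^1(1-x^2)^{\frac{n-2}2}C_2^2\,dx}=-\frac{(n+1)!\,(n-1)^2}{n+5}\neq0 .$$ -/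

import Mathlib

open MeasureTheory Polynomial Set
open scoped Topology ContDiff ENNReal

noncomputable section

namespace AxialPaneitz

/-- Axially symmetric functions on `𝕊ⁿ` are functions `u = u(x)` of the first coordinate
`x = ξ₁ ∈ (-1, 1)`; the surface measure then becomes, up to a constant factor, the measure
`(1 - x²)^((n-2)/2) dx` on `(-1, 1)`.  (Used for `n ≥ 2` only, where the subtraction is exact.) -/
def axialMeasure (n : ℕ) : Measure ℝ :=
  (volume.restrict (Ioo (-1 : ℝ) 1)).withDensity
    (fun x => ENNReal.ofReal ((1 - x ^ 2) ^ (((n - 2 : ℕ) : ℝ) / 2)))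

/-- The constant `√π Γ(n/2) / Γ((n+1)/2)`, the total mass of `axialMeasure n` for `n ≥ 2`. -/
def sphereConst (n : ℕ) : ℝ :=
  Real.sqrt Real.pi * Real.Gamma ((n : ℝ) / 2) / Real.Gamma (((n : ℝ) + 1) / 2)

/-- The axially symmetric functions in `L²(𝕊ⁿ)`. -/
abbrev AxialL2 (n : ℕ) : Type := Lp ℝ 2 (axialMeasure n)

/-- `-Δ` of `𝕊ⁿ` on polynomials in `x = ξ₁`:  `-(1 - x²) φ'' + n x φ'`. -/
def negLaplacian (n : ℕ) (φ : ℝ[X]) : ℝ[X] :=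
  -((1 - X ^ 2) * derivative (derivative φ)) + (n : ℝ[X]) * X * derivative φ

/-- `f = g(-Δ) u` in the sense of the functional calculus of the self-adjoint operator `-Δ` on the
axially symmetric part of `L²(𝕊ⁿ)`.  The axially symmetric eigenfunctions of `-Δ` are polynomials
in `x`; on an eigenfunction with eigenvalue `m` the operator `g(-Δ)` acts as multiplication by
`g m`. -/
def IsLaplacianFunction (n : ℕ) (g : ℝ → ℝ) (u f : AxialL2 n) : Prop :=
  ∀ (φ : ℝ[X]) (m : ℝ), negLaplacian n φ = m • φ →
    ∫ x, f x * φ.eval x ∂(axialMeasure n) = g m * ∫ x, u x * φ.eval x ∂(axialMeasure n)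

/-- The function `p` with `P_n = p(-Δ)`, `P_n` the Paneitz operator on `𝕊ⁿ`. -/
def paneitzSymbol (n : ℕ) (t : ℝ) : ℝ :=
  if Even n then
    ∏ j ∈ Finset.range (n / 2), (t + (j : ℝ) * ((n : ℝ) - j - 1))
  else
    Real.sqrt (t + (((n : ℝ) - 1) / 2) ^ 2) *
      ∏ j ∈ Finset.range ((n - 1) / 2), (t + (j : ℝ) * ((n : ℝ) - j - 1))

/-- `f = P_n u`. -/
def IsPaneitz (n : ℕ) (u f : AxialL2 n) : Prop :=
  IsLaplacianFunction n (paneitzSymbol n) u f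

instance instIsFiniteMeasureAxialMeasure (n : ℕ) : IsFiniteMeasure (axialMeasure n) := by
  refine isFiniteMeasure_withDensity_ofReal (f := fun x : ℝ =>
    (1 - x ^ 2) ^ (((n - 2 : ℕ) : ℝ) / 2)) ?_
  refine HasFiniteIntegral.of_bounded (C := 1) ?_
  filter_upwards [ae_restrict_mem measurableSet_Ioo] with x hx
  have h0 : (0 : ℝ) ≤ 1 - x ^ 2 := by nlinarith [hx.1, hx.2]
  have h1 : (1 : ℝ) - x ^ 2 ≤ 1 := by nlinarith [sq_nonneg x]
  rw [Real.norm_of_nonneg (Real.rpow_nonneg h0 _)]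
  exact Real.rpow_le_one h0 h1 (by positivity)

theorem ae_mem_axialMeasure (n : ℕ) : ∀ᵐ x ∂(axialMeasure n), x ∈ Ioo (-1 : ℝ) 1 :=
  (withDensity_absolutelyContinuous _ _).ae_le (ae_restrict_mem measurableSet_Ioo)

theorem integrable_axialL2 {n : ℕ} (u : AxialL2 n) : Integrable (fun x => u x) (axialMeasure n) :=
  (Lp.memLp u).integrable (by norm_num)

theorem integrable_mul_polynomial {n : ℕ} (u : AxialL2 n) (φ : ℝ[X]) :
    Integrable (fun x => u x * φ.eval x) (axialMeasure n) := by
  obtain ⟨c, hc⟩ := (isCompact_Icc (a := (-1 : ℝ)) (b := 1)).exists_bound_of_continuousOn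
    φ.continuous.continuousOn
  refine (integrable_axialL2 u).mul_bdd (c := c) φ.continuous.aestronglyMeasurable ?_
  filter_upwards [ae_mem_axialMeasure n] with x hx
  exact hc x ⟨hx.1.le, hx.2.le⟩

theorem integral_add_mul {n : ℕ} (u v : AxialL2 n) (φ : ℝ[X]) :
    ∫ x, (u + v : AxialL2 n) x * φ.eval x ∂(axialMeasure n) =
      ∫ x, u x * φ.eval x ∂(axialMeasure n) + ∫ x, v x * φ.eval x ∂(axialMeasure n) := by
  rw [← integral_add (integrable_mul_polynomial u φ) (integrable_mul_polynomial v φ)]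
  refine integral_congr_ae ?_
  filter_upwards [Lp.coeFn_add u v] with x hx
  rw [hx, Pi.add_apply, add_mul]

theorem integral_smul_mul {n : ℕ} (c : ℝ) (u : AxialL2 n) (φ : ℝ[X]) :
    ∫ x, (c • u : AxialL2 n) x * φ.eval x ∂(axialMeasure n) =
      c * ∫ x, u x * φ.eval x ∂(axialMeasure n) := by
  rw [← integral_const_mul]
  refine integral_congr_ae ?_
  filter_upwards [Lp.coeFn_smul c u] with x hx
  rw [hx, Pi.smul_apply, smul_eq_mul, mul_assoc]

theorem integral_zero_mul {n : ℕ} (φ : ℝ[X]) :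
    ∫ x, (0 : AxialL2 n) x * φ.eval x ∂(axialMeasure n) = 0 := by
  have h := integral_smul_mul (n := n) 0 0 φ
  rwa [zero_smul, zero_mul] at h

/-- The space `𝒱` of axially symmetric functions of mean zero in `H^n(𝕊ⁿ)`.  Here `u ∈ H^n` means
`(1 - Δ)^(n/2) u ∈ L²`; an element is the pair `(u, (1 - Δ)^(n/2) u)`, and the norm
`(‖u‖² + ‖(1 - Δ)^(n/2) u‖²)^(1/2)` is inherited from `L² × L²`. -/
def axialSobolev (n : ℕ) : Submodule ℝ (WithLp 2 (AxialL2 n × AxialL2 n)) where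
  carrier := {p | IsLaplacianFunction n (fun t => (1 + t) ^ ((n : ℝ) / 2)) p.fst p.snd ∧
    ∫ x, p.fst x ∂(axialMeasure n) = 0}
  add_mem' := by
    rintro p q ⟨hp, hp0⟩ ⟨hq, hq0⟩
    refine ⟨fun φ m h => ?_, ?_⟩
    · rw [WithLp.add_fst, WithLp.add_snd, integral_add_mul, integral_add_mul, hp φ m h, hq φ m h,
        mul_add]
    · have h := integral_add_mul p.fst q.fst 1
      simp only [eval_one, mul_one] at h
      rw [WithLp.add_fst, h, hp0, hq0, add_zero]
  zero_mem' := by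
    refine ⟨fun φ m _ => ?_, ?_⟩
    · rw [WithLp.zero_fst, WithLp.zero_snd, integral_zero_mul, mul_zero]
    · have h := integral_zero_mul (n := n) 1
      simp only [eval_one, mul_one] at h
      rw [WithLp.zero_fst, h]
  smul_mem' := by
    rintro c p ⟨hp, hp0⟩
    refine ⟨fun φ m h => ?_, ?_⟩
    · rw [WithLp.smul_fst, WithLp.smul_snd, integral_smul_mul, integral_smul_mul, hp φ m h]
      ring
    · have h := integral_smul_mul c p.fst 1
      simp only [eval_one, mul_one] at h
      rw [WithLp.smul_fst, h, hp0, mul_zero]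

/-- The underlying function of an element of `axialSobolev n`. -/
def toFn {n : ℕ} (v : axialSobolev n) : AxialL2 n := v.1.fst

/-- `(ρ, u)` with `u ∈ 𝒱` solves `P_n u + ρ (1 - e^{nu} / ∫_{𝕊ⁿ} e^{nu} dw) = 0`, where `dw` is the
normalized surface measure, so that `∫_{𝕊ⁿ} e^{nu} dw` is
`(∫ (1 - x²)^((n-2)/2) e^{nu} dx) / sphereConst n`. -/
def IsSolution (n : ℕ) (ρ : ℝ) (v : axialSobolev n) : Prop :=
  ∃ f : AxialL2 n, IsPaneitz n (toFn v) f ∧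
    ∀ᵐ x ∂(axialMeasure n),
      f x + ρ * (1 - sphereConst n *
        (Real.exp (n * toFn v x) / ∫ y, Real.exp (n * toFn v y) ∂(axialMeasure n))) = 0

/-- For even `n`, the function `u ∈ 𝒱` solves the ordinary differential equation
`(-1)^(n/2) [(1 - x²)^(n/2) u']^(n-1) + ρ (1 - sphereConst n * e^{nu} / ∫ (1 - x²)^((n-2)/2) e^{nu}) = 0`
on `(-1, 1)` in the sense of distributions (the sign from the `n` integrations by parts is
`(-1)^n = 1`). -/
def SolvesODE (n : ℕ) (ρ : ℝ) (v : axialSobolev n) : Prop :=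
  ∀ ψ : ℝ → ℝ, ContDiff ℝ ∞ ψ → HasCompactSupport ψ → tsupport ψ ⊆ Ioo (-1 : ℝ) 1 →
    (-1 : ℝ) ^ (n / 2) * (∫ x in Ioo (-1 : ℝ) 1,
        toFn v x * deriv (fun y => (1 - y ^ 2) ^ (n / 2) * iteratedDeriv (n - 1) ψ y) x)
      + ρ * (∫ x in Ioo (-1 : ℝ) 1, (1 - sphereConst n *
          (Real.exp (n * toFn v x) / ∫ y, Real.exp (n * toFn v y) ∂(axialMeasure n))) * ψ x) = 0

/-- The set of nontrivial solutions `(ρ, u)`. -/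
def nontrivialSolutions (n : ℕ) : Set (ℝ × axialSobolev n) :=
  {p | IsSolution n p.1 p.2 ∧ p.2 ≠ 0}

/-- `(ρ₀, 0)` is a bifurcation point for the curve of trivial solutions `(ρ, 0)`. -/
def IsBifurcationPoint (n : ℕ) (ρ₀ : ℝ) : Prop :=
  (∀ᶠ ρ in 𝓝 ρ₀, IsSolution n ρ 0) ∧ (ρ₀, (0 : axialSobolev n)) ∈ closure (nontrivialSolutions n)

/-- The Gegenbauer polynomials `C_k^ν`, by their three-term recursion. -/
def gegenbauer (ν : ℝ) : ℕ → ℝ[X]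
  | 0 => 1
  | 1 => C (2 * ν) * X
  | (k + 2) => C (((k : ℝ) + 2)⁻¹) *
      (C (2 * ((k : ℝ) + 1 + ν)) * X * gegenbauer ν (k + 1) - C ((k : ℝ) + 2 * ν) * gegenbauer ν k)

/-- `C_k^{(n-1)/2}`. -/
def sphereGegenbauer (n k : ℕ) : ℝ[X] := gegenbauer (((n : ℝ) - 1) / 2) k

/-- `λ_k = k (k+1) ⋯ (k+n-1)`. -/
def eigenvalue (n k : ℕ) : ℝ := ∏ s ∈ Finset.range n, ((k : ℝ) + s)

/-- `ρ_k = λ_k / n`. -/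
def bifValue (n k : ℕ) : ℝ := eigenvalue n k / n

/-- `r, ψ` on `(-ε₀, ε₀)` are a `C¹` parametrization `ε ↦ (r ε, ε w + ε ψ ε)` of all nontrivial
solutions near `(ρ_k, 0)`, where `w ∈ 𝒱` is the function `C_k` and `ψ` takes values in `C_k^⊥`. -/
structure IsLocalBranch (n k : ℕ) (w : axialSobolev n) (ε₀ : ℝ) (r : ℝ → ℝ)
    (ψ : ℝ → axialSobolev n) : Prop where
  pos : 0 < ε₀
  contDiff_r : ContDiffOn ℝ 1 r (Ioo (-ε₀) ε₀)
  contDiff_ψ : ContDiffOn ℝ 1 ψ (Ioo (-ε₀) ε₀)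
  r_zero : r 0 = bifValue n k
  ψ_zero : ψ 0 = 0
  orthogonal : ∀ ε ∈ Ioo (-ε₀) ε₀,
    ∫ x, toFn (ψ ε) x * (sphereGegenbauer n k).eval x ∂(axialMeasure n) = 0
  solutions : ∃ U : Set (ℝ × axialSobolev n), IsOpen U ∧ (bifValue n k, 0) ∈ U ∧
    nontrivialSolutions n ∩ U =
      {p | ∃ ε ∈ Ioo (-ε₀) ε₀, ε ≠ 0 ∧ p = (r ε, ε • w + ε • ψ ε)}

/-- A local branch with `ρ`-component `r` is transcritical if it crosses the level `r 0`: the values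
`r ε` and `r (-ε)` lie strictly on opposite sides of `r 0` for small `ε > 0`. -/
def IsTranscritical (r : ℝ → ℝ) : Prop :=
  ∃ δ > 0, ∀ ε ∈ Ioo (0 : ℝ) δ, (r ε - r 0) * (r (-ε) - r 0) < 0

end AxialPaneitz

end

/-!
The zonal functions in `L²(𝕊ⁿ)` have the Gegenbauer polynomials `C_k` as an orthogonal basis, and
`P_n` acts on `C_k` as multiplication by `λ_k = k (k + 1) ⋯ (k + n - 1)`. So everything linear is
diagonal: the functional calculus (`isPaneitz_iff`), the Green operator `P_n⁻¹ : L² → 𝒱` (`green`),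
and the Sobolev embedding of `𝒱` into the bounded continuous functions (`exists_embedding`), which
follows from Cauchy–Schwarz and the values `C_k(1) = max |C_k|`. Through the embedding, `e^{nu}` is an
entire function on a Banach algebra, and the equation becomes `u = ρ N(u)` with the smooth map
`N(u) = P_n⁻¹ (e^{nu} / ∫ e^{nu} dw)` (`isSolution_iff`).

The linearization of `N` at `0` is `n P_n⁻¹`, with simple characteristic values `ρ_k = λ_k / n`. The
theorem of Crandall and Rabinowitz (`crandall_rabinowitz`) is proved in the form needed: write
`N(ε z) = ε M(ε, z)` with a smooth `M` (`blowup`), divide the equation for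
`u = ε C_k + ε ψ` by `ε`, and apply the implicit function theorem to the unknowns `ρ` and `ψ ⊥ C_k`. A
solution near `(ρ_k, 0)` has the form `ε (C_k + ψ)` with small `ψ`
(`eventually_norm_complement_le`), which gives the uniqueness. Differentiating at `ε = 0` yields
`ρ_k'(0) = -(λ_k / 2) ∫ C_k³ / ∫ C_k²` (`exists_localBranch`); for `k = 2` the two integrals are
computed from the moments of the measure, and a nonzero derivative makes the bifurcation
transcritical.

For even `n`, the operator `(-1)^(n/2) [(1 - x²)^(n/2) u']^(n-1)` maps `C_k` to `λ_k C_k`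
(`paneitz_sphereGegenbauer`). By Parseval its formal adjoint, applied to a test function `ψ` and
paired with `u ∈ 𝒱`, gives the pairing of `ψ` with `P_n u`, so the distributional equation is the
equation in `L²`.
-/

namespace AxialPaneitz

/-! ### Gegenbauer polynomials -/

theorem gegenbauer_rec (ν : ℝ) (k : ℕ) :
    C ((k : ℝ) + 2) * gegenbauer ν (k + 2) =
      C (2 * ((k : ℝ) + 1 + ν)) * X * gegenbauer ν (k + 1) -
        C ((k : ℝ) + 2 * ν) * gegenbauer ν k := by
  have h : (k : ℝ) + 2 ≠ 0 := by positivity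
  rw [gegenbauer, ← mul_assoc, ← C_mul, mul_inv_cancel₀ h, C_1, one_mul]

/-- Lowering and raising relations. The second is carried along because the induction step for the
first one needs it. -/
theorem gegenbauer_derivative_pair (ν : ℝ) (k : ℕ) :
    (1 - X ^ 2) * derivative (gegenbauer ν (k + 1)) =
        -(C ((k : ℝ) + 1) * X * gegenbauer ν (k + 1)) + C ((k : ℝ) + 2 * ν) * gegenbauer ν k ∧
      (1 - X ^ 2) * derivative (gegenbauer ν k) =
        C ((k : ℝ) + 2 * ν) * X * gegenbauer ν k - C ((k : ℝ) + 1) * gegenbauer ν (k + 1) := by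
  induction k with
  | zero =>
    simp only [gegenbauer, Nat.cast_zero, zero_add, derivative_mul, derivative_C, derivative_X,
      derivative_one, C_1]
    constructor <;> ring
  | succ k ih =>
    obtain ⟨ihA, ihB⟩ := ih
    have hrec := gegenbauer_rec ν k
    have hne : (C ((k : ℝ) + 2) : ℝ[X]) ≠ 0 := C_ne_zero.2 (by positivity)
    have hder := congrArg derivative hrec
    simp only [derivative_mul, derivative_C, derivative_X, derivative_sub] at hder
    push_cast
    refine ⟨mul_left_cancel₀ hne ?_, ?_⟩
    · simp only [map_add, map_mul, map_one, map_ofNat] at *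
      linear_combination (1 - X ^ 2) * hder + (2 * (C (k : ℝ) + 1 + C ν)) * X * ihA
        - (C (k : ℝ) + 2 * C ν) * ihB + (C (k : ℝ) + 2) * X * hrec
    · simp only [map_add, map_mul, map_one, map_ofNat] at *
      linear_combination ihA + hrec

theorem gegenbauer_ode (ν : ℝ) (k : ℕ) :
    (1 - X ^ 2) * derivative (derivative (gegenbauer ν k)) -
      C (2 * ν + 1) * X * derivative (gegenbauer ν k) +
      C ((k : ℝ) * (k + 2 * ν)) * gegenbauer ν k = 0 := by
  rcases k with _ | k
  · simp [gegenbauer]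
  obtain ⟨hA, hB⟩ := gegenbauer_derivative_pair ν k
  have hne : (1 - X ^ 2 : ℝ[X]) ≠ 0 := fun h => by
    have := congrArg (eval 0) h
    simp at this
  have hder := congrArg derivative hA
  simp only [derivative_mul, derivative_C, derivative_X, derivative_sub, derivative_neg,
    derivative_add, derivative_one, derivative_X_pow] at hder
  refine (mul_eq_zero.1 ?_).resolve_left hne
  push_cast at *
  simp only [map_add, map_mul, map_one, map_ofNat] at *
  linear_combination (1 - X ^ 2) * hder + (C (k : ℝ) + 2 * C ν) * hB
    - (C (k : ℝ) + 2 * C ν) * X * hA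

theorem gegenbauer_eval_one (ν : ℝ) (k : ℕ) :
    ((k : ℝ) + 1) * (gegenbauer ν (k + 1)).eval 1 = ((k : ℝ) + 2 * ν) * (gegenbauer ν k).eval 1 := by
  have h := congrArg (eval 1) (gegenbauer_derivative_pair ν k).1
  simp only [eval_mul, eval_sub, eval_one, eval_pow, eval_X, eval_add, eval_neg, eval_C] at h
  linarith

theorem gegenbauer_eval_neg_one (ν : ℝ) (k : ℕ) :
    (gegenbauer ν k).eval (-1) ^ 2 = (gegenbauer ν k).eval 1 ^ 2 := by
  induction k with
  | zero => simp [gegenbauer]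
  | succ k ih =>
    have h := congrArg (eval (-1)) (gegenbauer_derivative_pair ν k).1
    simp only [eval_mul, eval_sub, eval_one, eval_pow, eval_X, eval_add, eval_neg, eval_C] at h
    have h1 := gegenbauer_eval_one ν k
    have hk : ((k : ℝ) + 1) ^ 2 ≠ 0 := by positivity
    have h' : ((k : ℝ) + 1) * (gegenbauer ν (k + 1)).eval (-1) =
        -(((k : ℝ) + 2 * ν) * (gegenbauer ν k).eval (-1)) := by linarith
    refine mul_left_cancel₀ hk ?_
    rw [← mul_pow, ← mul_pow, h', h1, neg_sq, mul_pow, mul_pow, ih]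

/-- The value at `1` bounds a Gegenbauer polynomial on `[-1, 1]`: by the differential equation,
`k (k + 2ν) y² + (1 - x²) y'²` has derivative `4 ν x y'²`, hence is largest at the ends. -/
theorem gegenbauer_abs_le (ν : ℝ) (hν : 0 ≤ ν) (k : ℕ) (hk : 1 ≤ k) {x : ℝ}
    (hx : x ∈ Icc (-1 : ℝ) 1) :
    (gegenbauer ν k).eval x ^ 2 ≤ (gegenbauer ν k).eval 1 ^ 2 := by
  set y := gegenbauer ν k with hy
  set m : ℝ := (k : ℝ) * (k + 2 * ν) with hm
  have hmpos : 0 < m := by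
    have : (1 : ℝ) ≤ k := by exact_mod_cast hk
    positivity
  have hode : (1 - X ^ 2) * derivative (derivative y) - C (2 * ν + 1) * X * derivative y +
      C m * y = 0 := gegenbauer_ode ν k
  set E : ℝ[X] := C m * y ^ 2 + (1 - X ^ 2) * derivative y ^ 2 with hE
  have hE' : ∀ t, deriv (fun t => E.eval t) t = 4 * ν * t * (derivative y).eval t ^ 2 := by
    intro t
    rw [Polynomial.deriv]
    have h := congrArg (eval t) hode
    simp only [hE, derivative_mul, derivative_C, derivative_X, derivative_sub, derivative_add,
      derivative_one, derivative_pow, eval_mul, eval_sub, eval_one, eval_pow, eval_X, eval_add,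
      eval_C, eval_zero] at h ⊢
    simp
    linear_combination 2 * (derivative y).eval t * h
  have hmono : MonotoneOn (fun t => E.eval t) (Icc 0 1) := by
    refine monotoneOn_of_deriv_nonneg (convex_Icc _ _) E.continuous.continuousOn
      E.differentiable.differentiableOn fun t ht => ?_
    rw [interior_Icc] at ht
    rw [hE']
    have := ht.1
    positivity
  have hanti : AntitoneOn (fun t => E.eval t) (Icc (-1) 0) := by
    refine antitoneOn_of_deriv_nonpos (convex_Icc _ _) E.continuous.continuousOn
      E.differentiable.differentiableOn fun t ht => ?_
    rw [interior_Icc] at ht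
    rw [hE']
    have h1 : 0 ≤ ν * (derivative y).eval t ^ 2 := by positivity
    nlinarith [ht.2]
  have hle : E.eval x ≤ m * y.eval 1 ^ 2 := by
    rcases le_total 0 x with h0 | h0
    · refine (hmono ⟨h0, hx.2⟩ (right_mem_Icc.2 zero_le_one) hx.2).trans (le_of_eq ?_)
      simp [hE]
    · refine (hanti (left_mem_Icc.2 (by norm_num)) ⟨hx.1, h0⟩ hx.1).trans (le_of_eq ?_)
      simp [hE, hy, gegenbauer_eval_neg_one]
  have hge : m * y.eval x ^ 2 ≤ E.eval x := by
    have : 0 ≤ (1 - x ^ 2) * (derivative y).eval x ^ 2 :=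
      mul_nonneg (by nlinarith [hx.1, hx.2]) (sq_nonneg _)
    simp [hE]
    linarith
  exact le_of_mul_le_mul_left (hge.trans hle) hmpos

theorem span_gegenbauer (ν : ℝ) (hν : 0 < ν) :
    Submodule.span ℝ (range (gegenbauer ν)) = ⊤ := by
  set S := Submodule.span ℝ (range (gegenbauer ν)) with hS
  have hmem : ∀ k, gegenbauer ν k ∈ S := fun k => Submodule.subset_span ⟨k, rfl⟩
  have hX : ∀ p ∈ S, X * p ∈ S := by
    intro p hp
    induction hp using Submodule.span_induction with
    | mem p hp =>
      obtain ⟨k, rfl⟩ := hp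
      rcases k with _ | k
      · have : X * gegenbauer ν 0 = (2 * ν)⁻¹ • gegenbauer ν 1 := by
          rw [gegenbauer, gegenbauer, smul_eq_C_mul, ← mul_assoc, ← C_mul,
            inv_mul_cancel₀ (by positivity)]
          simp
        rw [this]
        exact S.smul_mem _ (hmem 1)
      · have h0 : (2 * ((k : ℝ) + 1 + ν)) ≠ 0 := by positivity
        have : X * gegenbauer ν (k + 1) = (2 * ((k : ℝ) + 1 + ν))⁻¹ •
            (((k : ℝ) + 2) • gegenbauer ν (k + 2) + ((k : ℝ) + 2 * ν) • gegenbauer ν k) := by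
          simp only [smul_eq_C_mul]
          rw [gegenbauer_rec, sub_add_cancel, ← mul_assoc, ← mul_assoc, ← C_mul,
            inv_mul_cancel₀ h0]
          simp
        rw [this]
        exact S.smul_mem _ (S.add_mem (S.smul_mem _ (hmem _)) (S.smul_mem _ (hmem _)))
    | zero => simp
    | add p q _ _ hp hq => rw [mul_add]; exact S.add_mem hp hq
    | smul c p _ hp => rw [mul_smul_comm]; exact S.smul_mem c hp
  have hpow : ∀ m : ℕ, (X ^ m : ℝ[X]) ∈ S := by
    intro m
    induction m with
    | zero => exact hmem 0
    | succ m ih => rw [pow_succ']; exact hX _ ih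
  refine Submodule.eq_top_iff'.2 fun p => ?_
  rw [p.as_sum_range_C_mul_X_pow]
  refine S.sum_mem fun i _ => ?_
  rw [← smul_eq_C_mul]
  exact S.smul_mem _ (hpow i)

theorem natDegree_gegenbauer_le (ν : ℝ) (k : ℕ) : (gegenbauer ν k).natDegree ≤ k := by
  induction k using Nat.twoStepInduction with
  | zero => simp [gegenbauer]
  | one => rw [gegenbauer]; exact (natDegree_C_mul_le _ _).trans natDegree_X_le
  | more k ih1 ih2 =>
    rw [gegenbauer]
    refine (natDegree_C_mul_le _ _).trans ((natDegree_sub_le _ _).trans (max_le ?_ ?_))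
    · rw [mul_assoc]
      refine (natDegree_C_mul_le _ _).trans (natDegree_mul_le.trans ?_)
      rw [natDegree_X]
      omega
    · exact (natDegree_C_mul_le _ _).trans (by omega)

/-! ### Eigenvalues of the Laplacian and of the Paneitz operator -/

/-- `-Δ` on `𝕊ⁿ` has eigenvalue `k (k + n - 1)` on `C_k`. -/
def laplaceEigenvalue (n k : ℕ) : ℝ := (k : ℝ) * ((k : ℝ) + n - 1)

theorem negLaplacian_sphereGegenbauer (n k : ℕ) :
    negLaplacian n (sphereGegenbauer n k) = laplaceEigenvalue n k • sphereGegenbauer n k := by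
  have h := gegenbauer_ode (((n : ℝ) - 1) / 2) k
  rw [show 2 * (((n : ℝ) - 1) / 2) + 1 = n by ring,
    show (k : ℝ) * (k + 2 * (((n : ℝ) - 1) / 2)) = laplaceEigenvalue n k by
      rw [laplaceEigenvalue]; ring, C_eq_natCast] at h
  rw [negLaplacian, smul_eq_C_mul, sphereGegenbauer]
  linear_combination -h

theorem sphereGegenbauer_zero (n : ℕ) : sphereGegenbauer n 0 = 1 := rfl

theorem laplaceEigenvalue_zero (n : ℕ) : laplaceEigenvalue n 0 = 0 := by simp [laplaceEigenvalue]

theorem laplaceEigenvalue_strictMono {n : ℕ} (hn : 2 ≤ n) : StrictMono (laplaceEigenvalue n) := by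
  refine strictMono_nat_of_lt_succ fun k => ?_
  have : (2 : ℝ) ≤ n := by exact_mod_cast hn
  simp only [laplaceEigenvalue]
  push_cast
  have : (0 : ℝ) ≤ k := k.cast_nonneg
  nlinarith

theorem laplaceEigenvalue_nonneg {n : ℕ} (hn : 2 ≤ n) (k : ℕ) : 0 ≤ laplaceEigenvalue n k := by
  rw [← laplaceEigenvalue_zero n]
  exact (laplaceEigenvalue_strictMono hn).monotone k.zero_le

theorem eigenvalue_pos (n : ℕ) {k : ℕ} (hk : 1 ≤ k) : 0 < eigenvalue n k :=
  Finset.prod_pos fun s _ => by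
    have : (1 : ℝ) ≤ k := by exact_mod_cast hk
    positivity

theorem eigenvalue_zero {n : ℕ} (hn : 2 ≤ n) : eigenvalue n 0 = 0 :=
  Finset.prod_eq_zero (Finset.mem_range.2 (by omega : 0 < n)) (by simp)

theorem eigenvalue_strictMono {n : ℕ} (hn : 2 ≤ n) : StrictMono (eigenvalue n) := by
  refine strictMono_nat_of_lt_succ fun k => ?_
  rcases k with _ | k
  · rw [eigenvalue_zero hn]
    exact eigenvalue_pos n le_rfl
  refine Finset.prod_lt_prod_of_nonempty (fun (s : ℕ) _ => by positivity) (fun (s : ℕ) _ => ?_)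
    (Finset.nonempty_range_iff.2 (by omega))
  push_cast
  linarith

/-- The factors `k (k + n - 1) + j (n - j - 1) = (k + j) (k + n - 1 - j)` of the symbol pair up the
factors of `k (k + 1) ⋯ (k + n - 1)` from the two ends. -/
theorem prod_laplaceEigenvalue_add (n m : ℕ) (hm : 2 * m ≤ n) (k : ℕ) :
    (∏ j ∈ Finset.range m, (laplaceEigenvalue n k + (j : ℝ) * ((n : ℝ) - j - 1))) *
      ∏ s ∈ Finset.Ico m (n - m), ((k : ℝ) + s) = eigenvalue n k := by
  induction m with
  | zero => rw [Finset.range_zero, Finset.prod_empty, one_mul, Nat.sub_zero, eigenvalue,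
      Finset.range_eq_Ico]
  | succ m ih =>
    rw [← ih (by omega), Finset.prod_range_succ, mul_assoc]
    congr 1
    have h1 : n - m = (n - (m + 1)) + 1 := by omega
    rw [Finset.prod_eq_prod_Ico_succ_bot (by omega : m < n - m), h1,
      Finset.prod_Ico_succ_top (by omega : m + 1 ≤ n - (m + 1)), Nat.cast_sub (by omega),
      laplaceEigenvalue]
    push_cast
    ring

theorem paneitzSymbol_laplaceEigenvalue {n : ℕ} (hn : 2 ≤ n) (k : ℕ) :
    paneitzSymbol n (laplaceEigenvalue n k) = eigenvalue n k := by
  rw [paneitzSymbol]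
  split_ifs with h
  · obtain ⟨m, rfl⟩ := h
    rw [← prod_laplaceEigenvalue_add _ ((m + m) / 2) (by omega),
      show m + m - (m + m) / 2 = (m + m) / 2 by omega]
    simp
  · obtain ⟨m, rfl⟩ := Nat.not_even_iff_odd.1 h
    have hd : (2 * m + 1 - 1) / 2 = m := by omega
    rw [hd, ← prod_laplaceEigenvalue_add _ m (by omega), mul_comm,
      show 2 * m + 1 - m = m + 1 by omega, Nat.Ico_succ_singleton, Finset.prod_singleton,
      laplaceEigenvalue]
    congr 1
    rw [Real.sqrt_eq_iff_mul_self_eq (by push_cast; ring_nf; positivity) (by positivity)]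
    push_cast
    ring

/-! ### Integrals of polynomials against the surface measure -/

theorem integral_axialMeasure (n : ℕ) (f : ℝ → ℝ) :
    ∫ x, f x ∂(axialMeasure n) =
      ∫ x in Ioo (-1 : ℝ) 1, (1 - x ^ 2) ^ (((n - 2 : ℕ) : ℝ) / 2) * f x := by
  rw [axialMeasure, integral_withDensity_eq_integral_toReal_smul (by fun_prop) (by simp)]
  refine setIntegral_congr_fun measurableSet_Ioo fun x hx => ?_
  have h0 : (0 : ℝ) ≤ 1 - x ^ 2 := by nlinarith [hx.1, hx.2]
  simp only [smul_eq_mul]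
  rw [ENNReal.toReal_ofReal (Real.rpow_nonneg h0 _)]

theorem integral_axialMeasure_eq_intervalIntegral (n : ℕ) (f : ℝ → ℝ) :
    ∫ x, f x ∂(axialMeasure n) =
      ∫ x in (-1 : ℝ)..1, (1 - x ^ 2) ^ (((n - 2 : ℕ) : ℝ) / 2) * f x := by
  rw [integral_axialMeasure, intervalIntegral.integral_of_le (by norm_num),
    integral_Ioc_eq_integral_Ioo]

theorem integrable_polynomial (n : ℕ) (φ : ℝ[X]) :
    Integrable (fun x => φ.eval x) (axialMeasure n) := by
  obtain ⟨c, hc⟩ := (isCompact_Icc (a := (-1 : ℝ)) (b := 1)).exists_bound_of_continuousOn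
    φ.continuous.continuousOn
  refine Integrable.of_bound φ.continuous.aestronglyMeasurable c ?_
  filter_upwards [ae_mem_axialMeasure n] with x hx
  exact hc x ⟨hx.1.le, hx.2.le⟩

/-- Integration of polynomials against `axialMeasure n`, as a linear functional. -/
noncomputable def polyIntegral (n : ℕ) : ℝ[X] →ₗ[ℝ] ℝ where
  toFun φ := ∫ x, φ.eval x ∂(axialMeasure n)
  map_add' φ ψ := by
    simp only [eval_add]
    exact integral_add (integrable_polynomial n φ) (integrable_polynomial n ψ)
  map_smul' c φ := by
    simp only [eval_smul, smul_eq_mul, RingHom.id_apply]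
    exact integral_const_mul _ _

theorem polyIntegral_apply (n : ℕ) (φ : ℝ[X]) :
    polyIntegral n φ = ∫ x, φ.eval x ∂(axialMeasure n) := rfl

theorem polyIntegral_C_mul (n : ℕ) (c : ℝ) (φ : ℝ[X]) :
    polyIntegral n (C c * φ) = c * polyIntegral n φ := by
  rw [← smul_eq_C_mul, map_smul, smul_eq_mul]

/-- The divergence theorem: the integrand times the weight is the derivative of
`(1 - x²)^(n/2) p`, which vanishes at `±1`. -/
theorem polyIntegral_divergence {n : ℕ} (hn : 2 ≤ n) (p : ℝ[X]) :
    polyIntegral n ((1 - X ^ 2) * derivative p - C (n : ℝ) * X * p) = 0 := by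
  rw [polyIntegral_apply, integral_axialMeasure_eq_intervalIntegral]
  have hn' : (2 : ℝ) ≤ n := by exact_mod_cast hn
  have he : (n : ℝ) / 2 - 1 = ((n - 2 : ℕ) : ℝ) / 2 := by
    rw [Nat.cast_sub hn]; push_cast; ring
  have hderiv : ∀ x ∈ uIcc (-1 : ℝ) 1, HasDerivAt (fun x => (1 - x ^ 2) ^ ((n : ℝ) / 2) * p.eval x)
      ((1 - x ^ 2) ^ (((n - 2 : ℕ) : ℝ) / 2) *
        ((1 - X ^ 2) * derivative p - C (n : ℝ) * X * p).eval x) x := by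
    intro x hx
    rw [uIcc_of_le (by norm_num)] at hx
    have h0 : (0 : ℝ) ≤ 1 - x ^ 2 := by nlinarith [hx.1, hx.2]
    have h1 : HasDerivAt (fun x : ℝ => 1 - x ^ 2) (-(2 * x)) x := by
      simpa using (hasDerivAt_pow 2 x).const_sub 1
    have h2 := (h1.rpow_const (p := (n : ℝ) / 2) (Or.inr (by linarith))).mul (p.hasDerivAt x)
    refine h2.congr_deriv ?_
    have h3 : (1 - x ^ 2) ^ ((n : ℝ) / 2) =
        (1 - x ^ 2) ^ (((n - 2 : ℕ) : ℝ) / 2) * (1 - x ^ 2) := by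
      rw [← he]
      conv_rhs => rw [← Real.rpow_one (1 - x ^ 2), ← Real.rpow_mul h0, one_mul]
      rw [← Real.rpow_add_of_nonneg h0 (by linarith) zero_le_one]
      congr 1
      ring
    rw [h3, he]
    simp only [eval_mul, eval_sub, eval_one, eval_pow, eval_X, eval_C]
    ring
  rw [intervalIntegral.integral_eq_sub_of_hasDerivAt hderiv]
  · have : (n : ℝ) / 2 ≠ 0 := by positivity
    norm_num [Real.zero_rpow this]
  · refine Continuous.intervalIntegrable (Continuous.mul ?_ (Polynomial.continuous _)) _ _
    exact (by fun_prop : Continuous fun x : ℝ => 1 - x ^ 2).rpow_const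
      fun _ => Or.inr (by positivity)

theorem polyIntegral_negLaplacian_mul {n : ℕ} (hn : 2 ≤ n) (φ ψ : ℝ[X]) :
    polyIntegral n (negLaplacian n φ * ψ) = polyIntegral n (φ * negLaplacian n ψ) := by
  rw [← sub_eq_zero, ← map_sub, ← neg_eq_zero, ← map_neg,
    ← polyIntegral_divergence hn (derivative φ * ψ - φ * derivative ψ)]
  congr 1
  simp only [negLaplacian, derivative_mul, derivative_sub, C_eq_natCast]
  ring

theorem polyIntegral_sphereGegenbauer_mul {n : ℕ} (hn : 2 ≤ n) {j k : ℕ} (hjk : j ≠ k) :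
    polyIntegral n (sphereGegenbauer n j * sphereGegenbauer n k) = 0 := by
  have h := polyIntegral_negLaplacian_mul hn (sphereGegenbauer n j) (sphereGegenbauer n k)
  rw [negLaplacian_sphereGegenbauer, negLaplacian_sphereGegenbauer, smul_mul_assoc,
    mul_smul_comm, map_smul, map_smul, smul_eq_mul, smul_eq_mul] at h
  have hne := (laplaceEigenvalue_strictMono hn).injective.ne hjk
  have : (laplaceEigenvalue n j - laplaceEigenvalue n k) *
      polyIntegral n (sphereGegenbauer n j * sphereGegenbauer n k) = 0 := by linarith
  exact (mul_eq_zero.1 this).resolve_left (sub_ne_zero.2 hne)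

theorem polyIntegral_moment {n : ℕ} (hn : 2 ≤ n) (j : ℕ) :
    ((n : ℝ) + j + 1) * polyIntegral n (X ^ (j + 2)) = ((j : ℝ) + 1) * polyIntegral n (X ^ j) := by
  have h := polyIntegral_divergence hn (X ^ (j + 1))
  rw [show (1 - X ^ 2) * derivative (X ^ (j + 1)) - C (n : ℝ) * X * X ^ (j + 1) =
    C ((j : ℝ) + 1) * X ^ j - C ((n : ℝ) + j + 1) * (X ^ (j + 2) : ℝ[X]) by
      rw [derivative_X_pow]
      simp
      ring, map_sub, polyIntegral_C_mul, polyIntegral_C_mul] at h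
  linarith

theorem integral_sqrt_one_sub_sq_Ioo : ∫ x in Ioo (-1 : ℝ) 1, Real.sqrt (1 - x ^ 2) =
    Real.pi / 2 := by
  rw [← integral_Ioc_eq_integral_Ioo, ← intervalIntegral.integral_of_le (by norm_num)]
  exact integral_sqrt_one_sub_sq

theorem polyIntegral_one_add_two {n : ℕ} (hn : 2 ≤ n) :
    polyIntegral (n + 2) 1 = polyIntegral n (1 - X ^ 2) := by
  simp only [polyIntegral_apply, integral_axialMeasure]
  refine setIntegral_congr_fun measurableSet_Ioo fun x hx => ?_
  have h0 : (0 : ℝ) < 1 - x ^ 2 := by nlinarith [hx.1, hx.2]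
  simp only [eval_one, eval_sub, eval_pow, eval_X, mul_one]
  rw [← Real.rpow_add_one h0.ne', Nat.cast_sub (by omega), Nat.cast_sub hn]
  congr 1
  push_cast
  ring

theorem polyIntegral_one {n : ℕ} (hn : 2 ≤ n) : polyIntegral n 1 = sphereConst n := by
  induction n using Nat.twoStepInduction with
  | zero => omega
  | one => omega
  | more n ih _ =>
    rcases n with _ | _ | n
    · have h : Real.Gamma (3 / 2) = 1 / 2 * Real.sqrt Real.pi := by
        rw [show (3 : ℝ) / 2 = 1 / 2 + 1 by norm_num, Real.Gamma_add_one (by norm_num),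
          Real.Gamma_one_half_eq]
      rw [polyIntegral_apply, integral_axialMeasure, sphereConst]
      norm_num [h]
      field_simp
    · have h : Real.Gamma (3 / 2) = 1 / 2 * Real.sqrt Real.pi := by
        rw [show (3 : ℝ) / 2 = 1 / 2 + 1 by norm_num, Real.Gamma_add_one (by norm_num),
          Real.Gamma_one_half_eq]
      have h2 : ∫ x in Ioo (-1 : ℝ) 1, (1 - x ^ 2) ^ ((1 : ℝ) / 2) = Real.pi / 2 := by
        rw [← integral_sqrt_one_sub_sq_Ioo]
        simp only [Real.sqrt_eq_rpow]
      rw [polyIntegral_apply, integral_axialMeasure, sphereConst]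
      norm_num [h, Real.Gamma_two] at h2 ⊢
      rw [h2]
      have := Real.mul_self_sqrt Real.pi_pos.le
      linarith
    -- From dimension `n` to `n + 2` the weight gains a factor `1 - x²`.
    · have hmom := polyIntegral_moment (n := n + 2) (by omega) 0
      have ih := ih (by omega)
      rw [polyIntegral_one_add_two (by omega), map_sub, ih]
      rw [pow_zero, ih] at hmom
      have hne : ((n : ℝ) + 3) ≠ 0 := by positivity
      have hX : polyIntegral (n + 2) (X ^ 2) = sphereConst (n + 2) / ((n : ℝ) + 3) := by
        rw [eq_div_iff hne]
        push_cast at hmom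
        linarith
      have e1 : ((n + 2 + 2 : ℕ) : ℝ) / 2 = ((n + 2 : ℕ) : ℝ) / 2 + 1 := by push_cast; ring
      have e2 : (((n + 2 + 2 : ℕ) : ℝ) + 1) / 2 = (((n + 2 : ℕ) : ℝ) + 1) / 2 + 1 := by
        push_cast; ring
      have h1 : (0 : ℝ) < ((n + 2 : ℕ) : ℝ) / 2 := by positivity
      have h2 : (0 : ℝ) < (((n + 2 : ℕ) : ℝ) + 1) / 2 := by positivity
      have h3 := (Real.Gamma_pos_of_pos h2).ne'
      rw [hX, sphereConst, sphereConst, e1, e2, Real.Gamma_add_one h1.ne',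
        Real.Gamma_add_one h2.ne']
      field_simp
      push_cast
      ring

theorem sphereConst_pos {n : ℕ} (hn : 2 ≤ n) : 0 < sphereConst n := by
  have h1 : (0 : ℝ) < (n : ℝ) / 2 := by positivity
  have h2 : (0 : ℝ) < ((n : ℝ) + 1) / 2 := by positivity
  have := Real.Gamma_pos_of_pos h1
  have := Real.Gamma_pos_of_pos h2
  rw [sphereConst]
  positivity

/-- The squared norm `∫ (1 - x²)^((n-2)/2) C_k²`. -/
noncomputable def gegenbauerNormSq (n k : ℕ) : ℝ := polyIntegral n (sphereGegenbauer n k ^ 2)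

theorem gegenbauerNormSq_zero {n : ℕ} (hn : 2 ≤ n) : gegenbauerNormSq n 0 = sphereConst n := by
  rw [gegenbauerNormSq, sphereGegenbauer_zero, one_pow, polyIntegral_one hn]

/-- Both squared norms are multiples of `∫ x C_k C_{k+1}`, by the recursion paired with `C_k` and
with `C_{k+1}`. -/
theorem gegenbauerNormSq_succ {n : ℕ} (hn : 2 ≤ n) (k : ℕ) :
    ((k : ℝ) + 1) * (k + 1 + ((n : ℝ) - 1) / 2) * gegenbauerNormSq n (k + 1) =
      (k + ((n : ℝ) - 1) / 2) * (k + n - 1) * gegenbauerNormSq n k := by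
  set ν : ℝ := ((n : ℝ) - 1) / 2 with hν
  have hn' : (2 : ℝ) ≤ n := by exact_mod_cast hn
  have hνpos : 0 < ν := by rw [hν]; linarith
  have hn2 : (n : ℝ) = 2 * ν + 1 := by rw [hν]; ring
  set a : ℕ → ℝ := fun k => polyIntegral n (X * sphereGegenbauer n k * sphereGegenbauer n (k + 1))
    with ha
  have hlow : ∀ k : ℕ, 2 * ((k : ℝ) + 1 + ν) * a k = ((k : ℝ) + 2 * ν) * gegenbauerNormSq n k := by
    intro k
    have h := congrArg (fun p => polyIntegral n (p * sphereGegenbauer n k)) (gegenbauer_rec ν k)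
    simp only [sub_mul, mul_assoc, map_sub, polyIntegral_C_mul] at h
    change ((k : ℝ) + 2) * polyIntegral n (sphereGegenbauer n (k + 2) * sphereGegenbauer n k) =
      2 * (((k : ℝ) + 1 + ν) * polyIntegral n (X * (sphereGegenbauer n (k + 1) *
        sphereGegenbauer n k))) - ((k : ℝ) + 2 * ν) *
          polyIntegral n (sphereGegenbauer n k * sphereGegenbauer n k) at h
    rw [polyIntegral_sphereGegenbauer_mul hn (by omega), mul_zero] at h
    rw [ha, gegenbauerNormSq, sq]
    rw [mul_comm (sphereGegenbauer n (k + 1)), ← mul_assoc X] at h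
    linarith
  have hup : ∀ k : ℕ, ((k : ℝ) + 1) * gegenbauerNormSq n (k + 1) = 2 * ((k : ℝ) + ν) * a k := by
    intro k
    rcases k with _ | k
    · have h1 : sphereGegenbauer n 1 = C (2 * ν) * X := rfl
      have h2 : sphereGegenbauer n 1 ^ 2 =
          C (2 * ν) * (X * sphereGegenbauer n 0 * sphereGegenbauer n 1) := by
        rw [h1, sphereGegenbauer_zero]; ring
      rw [gegenbauerNormSq, h2, polyIntegral_C_mul]
      simp [ha]
    · have h := congrArg (fun p => polyIntegral n (p * sphereGegenbauer n (k + 2)))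
        (gegenbauer_rec ν k)
      simp only [sub_mul, mul_assoc, map_sub, polyIntegral_C_mul] at h
      change ((k : ℝ) + 2) * polyIntegral n (sphereGegenbauer n (k + 2) * sphereGegenbauer n (k + 2))
        = 2 * (((k : ℝ) + 1 + ν) * polyIntegral n (X * (sphereGegenbauer n (k + 1) *
          sphereGegenbauer n (k + 2)))) - ((k : ℝ) + 2 * ν) *
            polyIntegral n (sphereGegenbauer n k * sphereGegenbauer n (k + 2)) at h
      rw [polyIntegral_sphereGegenbauer_mul hn (j := k) (k := k + 2) (by omega), mul_zero] at h
      rw [ha, gegenbauerNormSq, sq]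
      rw [← mul_assoc X] at h
      push_cast
      linarith
  have h1 := hlow k
  have h2 := hup k
  rw [hn2]
  linear_combination ((k : ℝ) + 1 + ν) * h2 + ((k : ℝ) + ν) * h1

theorem gegenbauerNormSq_pos {n : ℕ} (hn : 2 ≤ n) (k : ℕ) : 0 < gegenbauerNormSq n k := by
  have hn' : (2 : ℝ) ≤ n := by exact_mod_cast hn
  induction k with
  | zero => rw [gegenbauerNormSq_zero hn]; exact sphereConst_pos hn
  | succ k ih =>
    have hk : (0 : ℝ) ≤ k := k.cast_nonneg
    have h := gegenbauerNormSq_succ hn k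
    have h1 : 0 < ((k : ℝ) + ((n : ℝ) - 1) / 2) * (k + n - 1) * gegenbauerNormSq n k :=
      mul_pos (mul_pos (by linarith) (by linarith)) ih
    rw [← h] at h1
    exact (pos_iff_pos_of_mul_pos h1).1 (mul_pos (by linarith) (by linarith))

theorem eigenvalue_succ (n k : ℕ) : (k : ℝ) * eigenvalue n (k + 1) = (k + n) * eigenvalue n k := by
  have h1 := Finset.prod_range_succ (fun s : ℕ => (k : ℝ) + s) n
  have h2 := Finset.prod_range_succ' (fun s : ℕ => (k : ℝ) + s) n
  rw [h1] at h2
  rw [eigenvalue, eigenvalue]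
  push_cast at h2 ⊢
  simp only [add_assoc, add_comm (1 : ℝ), add_zero] at h2 ⊢
  linarith

/-- The values at `1` of the Gegenbauer polynomials, relative to their norms and up to a factor
that depends on the dimension only: both sides obey the same recursion in `k`. -/
theorem exists_gegenbauer_eval_one_sq {n : ℕ} (hn : 2 ≤ n) : ∃ α : ℝ, ∀ k : ℕ, 1 ≤ k →
    (sphereGegenbauer n k).eval 1 ^ 2 * laplaceEigenvalue n k =
      α * (k + ((n : ℝ) - 1) / 2) * eigenvalue n k * gegenbauerNormSq n k := by
  have hn' : (2 : ℝ) ≤ n := by exact_mod_cast hn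
  have h1 := (gegenbauerNormSq_pos hn 1).ne'
  have h2 := (eigenvalue_pos n le_rfl).ne'
  have h3 : (1 : ℝ) + ((n : ℝ) - 1) / 2 ≠ 0 := by linarith
  refine ⟨(sphereGegenbauer n 1).eval 1 ^ 2 * laplaceEigenvalue n 1 /
    ((1 + ((n : ℝ) - 1) / 2) * eigenvalue n 1 * gegenbauerNormSq n 1), fun k hk => ?_⟩
  generalize hα : (sphereGegenbauer n 1).eval 1 ^ 2 * laplaceEigenvalue n 1 /
    ((1 + ((n : ℝ) - 1) / 2) * eigenvalue n 1 * gegenbauerNormSq n 1) = α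
  induction k, hk using Nat.le_induction with
  | base =>
    rw [div_eq_iff (mul_ne_zero (mul_ne_zero h3 h2) h1)] at hα
    rw [hα]
    push_cast
    ring
  | succ k hk ih =>
    have hk' : (1 : ℝ) ≤ k := by exact_mod_cast hk
    have hC := gegenbauer_eval_one (((n : ℝ) - 1) / 2) k
    change ((k : ℝ) + 1) * (sphereGegenbauer n (k + 1)).eval 1 =
      (k + 2 * (((n : ℝ) - 1) / 2)) * (sphereGegenbauer n k).eval 1 at hC
    have hN := gegenbauerNormSq_succ hn k
    have hE := eigenvalue_succ n k
    have hL : laplaceEigenvalue n (k + 1) = ((k : ℝ) + 1) * (k + n) := by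
      rw [laplaceEigenvalue]; push_cast; ring
    have hA : ((k : ℝ) + 1 + ((n : ℝ) - 1) / 2) ≠ 0 := by nlinarith
    rw [laplaceEigenvalue] at ih
    rw [hL]
    push_cast
    have hm : (k : ℝ) * (k + 1) * (k + 1 + ((n : ℝ) - 1) / 2) ≠ 0 := by positivity
    refine mul_left_cancel₀ hm ?_
    generalize (sphereGegenbauer n (k + 1)).eval 1 = y' at *
    generalize (sphereGegenbauer n k).eval 1 = y at *
    generalize eigenvalue n (k + 1) = l' at *
    generalize gegenbauerNormSq n (k + 1) = h' at *
    generalize eigenvalue n k = l at *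
    generalize gegenbauerNormSq n k = h at *
    generalize (n : ℝ) = N at *
    linear_combination (k : ℝ) * (k + N) * (k + 1 + (N - 1) / 2) *
        (((k : ℝ) + 1) * y' + (k + N - 1) * y) * hC +
      (k + N) * (k + N - 1) * (k + 1 + (N - 1) / 2) * ih -
      α * (k + 1 + (N - 1) / 2) * k * l' * hN -
      α * (k + 1 + (N - 1) / 2) * (k + (N - 1) / 2) * (k + N - 1) * h * hE

/-! ### The Gegenbauer basis of `L²` -/

theorem memLp_polynomial (n : ℕ) (φ : ℝ[X]) : MemLp (fun x => φ.eval x) 2 (axialMeasure n) := by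
  obtain ⟨c, hc⟩ := (isCompact_Icc (a := (-1 : ℝ)) (b := 1)).exists_bound_of_continuousOn
    φ.continuous.continuousOn
  refine MemLp.of_bound φ.continuous.aestronglyMeasurable c ?_
  filter_upwards [ae_mem_axialMeasure n] with x hx
  exact hc x ⟨hx.1.le, hx.2.le⟩

/-- Polynomials as elements of `L²`. -/
noncomputable def polyL2 (n : ℕ) : ℝ[X] →ₗ[ℝ] AxialL2 n where
  toFun φ := (memLp_polynomial n φ).toLp _
  map_add' φ ψ := by
    rw [← MemLp.toLp_add]
    simp only [eval_add]
    rfl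
  map_smul' c φ := by
    rw [RingHom.id_apply, ← MemLp.toLp_const_smul]
    simp only [eval_smul]
    rfl

theorem coeFn_polyL2 (n : ℕ) (φ : ℝ[X]) : polyL2 n φ =ᵐ[axialMeasure n] fun x => φ.eval x :=
  MemLp.coeFn_toLp (memLp_polynomial n φ)

theorem inner_polyL2_left {n : ℕ} (φ : ℝ[X]) (u : AxialL2 n) :
    inner ℝ (polyL2 n φ) u = ∫ x, u x * φ.eval x ∂(axialMeasure n) := by
  rw [L2.inner_def]
  refine integral_congr_ae ?_
  filter_upwards [coeFn_polyL2 n φ] with x hx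
  rw [hx]
  simp

theorem inner_polyL2_polyL2 (n : ℕ) (φ ψ : ℝ[X]) :
    inner ℝ (polyL2 n φ) (polyL2 n ψ) = polyIntegral n (φ * ψ) := by
  rw [inner_polyL2_left, polyIntegral_apply]
  refine integral_congr_ae ?_
  filter_upwards [coeFn_polyL2 n ψ] with x hx
  rw [hx, eval_mul, mul_comm]

/-- By Weierstrass, polynomials approximate bounded continuous functions uniformly on `[-1, 1]`,
and those are dense in `L²`. -/
theorem dense_range_polyL2 (n : ℕ) : DenseRange (polyL2 n) := by
  have hd := BoundedContinuousFunction.toLp_denseRange (p := 2) ℝ (axialMeasure n) ℝ (by norm_num)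
  refine dense_iff_closure_eq.2 (eq_univ_of_univ_subset ?_)
  rw [← hd.closure_eq]
  refine closure_minimal ?_ isClosed_closure
  rintro _ ⟨g, rfl⟩
  refine Metric.mem_closure_iff.2 fun ε hε => ?_
  set K : ℝ := measureUnivNNReal (axialMeasure n) ^ ((2 : ℝ≥0∞).toReal⁻¹) with hK
  have hK0 : 0 ≤ K := by positivity
  obtain ⟨p, hp⟩ := exists_polynomial_near_of_continuousOn (-1) 1 g g.continuous.continuousOn
    (ε / (K + 1)) (by positivity)
  refine ⟨_, ⟨p, rfl⟩, ?_⟩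
  rw [dist_eq_norm]
  have hle := Lp.norm_le_of_ae_bound (p := 2) (μ := axialMeasure n)
    (f := BoundedContinuousFunction.toLp 2 (axialMeasure n) ℝ g - polyL2 n p)
    (C := ε / (K + 1)) (by positivity) ?_
  · refine hle.trans_lt ?_
    rw [← hK, ← mul_div_assoc, div_lt_iff₀ (by positivity)]
    linarith
  · filter_upwards [Lp.coeFn_sub (BoundedContinuousFunction.toLp 2 (axialMeasure n) ℝ g)
      (polyL2 n p), BoundedContinuousFunction.coeFn_toLp 2 (axialMeasure n) ℝ g,
      coeFn_polyL2 n p, ae_mem_axialMeasure n] with x h1 h2 h3 hx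
    rw [h1, Pi.sub_apply, h2, h3, Real.norm_eq_abs, abs_sub_comm]
    exact (hp x ⟨hx.1.le, hx.2.le⟩).le

/-- The Gegenbauer polynomials, normalized in `L²`. -/
noncomputable def unitGegenbauer (n k : ℕ) : AxialL2 n :=
  (Real.sqrt (gegenbauerNormSq n k))⁻¹ • polyL2 n (sphereGegenbauer n k)

theorem orthonormal_unitGegenbauer {n : ℕ} (hn : 2 ≤ n) : Orthonormal ℝ (unitGegenbauer n) := by
  rw [orthonormal_iff_ite]
  intro j k
  rw [unitGegenbauer, unitGegenbauer, real_inner_smul_left, real_inner_smul_right,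
    inner_polyL2_polyL2]
  split_ifs with h
  · subst h
    have hpos := gegenbauerNormSq_pos hn j
    rw [← sq, ← gegenbauerNormSq]
    have := Real.mul_self_sqrt hpos.le
    have := (Real.sqrt_pos.2 hpos).ne'
    field_simp
    linarith
  · rw [polyIntegral_sphereGegenbauer_mul hn h, mul_zero, mul_zero]

theorem sphereGegenbauer_span {n : ℕ} (hn : 2 ≤ n) :
    Submodule.span ℝ (range (sphereGegenbauer n)) = ⊤ := by
  have hn' : (2 : ℝ) ≤ n := by exact_mod_cast hn
  exact span_gegenbauer (((n : ℝ) - 1) / 2) (by linarith)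

theorem span_unitGegenbauer {n : ℕ} (hn : 2 ≤ n) :
    ⊤ ≤ (Submodule.span ℝ (range (unitGegenbauer n))).topologicalClosure := by
  have hle : LinearMap.range (polyL2 n) ≤ Submodule.span ℝ (range (unitGegenbauer n)) := by
    rw [LinearMap.range_eq_map, ← sphereGegenbauer_span hn, Submodule.map_span,
      Submodule.span_le]
    rintro _ ⟨_, ⟨k, rfl⟩, rfl⟩
    have hpos := Real.sqrt_pos.2 (gegenbauerNormSq_pos hn k)
    have : polyL2 n (sphereGegenbauer n k) =
        Real.sqrt (gegenbauerNormSq n k) • unitGegenbauer n k := by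
      rw [unitGegenbauer, smul_smul, mul_inv_cancel₀ hpos.ne', one_smul]
    rw [this]
    exact Submodule.smul_mem _ _ (Submodule.subset_span ⟨k, rfl⟩)
  intro u _
  exact closure_mono (SetLike.coe_subset_coe.2 hle)
    (by simpa using (dense_range_polyL2 n).closure_range ▸ mem_univ u)

/-- The Hilbert basis of `L²` by normalized Gegenbauer polynomials. -/
noncomputable def gegenbauerBasis {n : ℕ} (hn : 2 ≤ n) : HilbertBasis ℕ ℝ (AxialL2 n) :=
  HilbertBasis.mk (orthonormal_unitGegenbauer hn) (span_unitGegenbauer hn)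

theorem gegenbauerBasis_apply {n : ℕ} (hn : 2 ≤ n) (k : ℕ) :
    gegenbauerBasis hn k = unitGegenbauer n k := by
  rw [gegenbauerBasis, HilbertBasis.coe_mk]

theorem repr_gegenbauerBasis {n : ℕ} (hn : 2 ≤ n) (u : AxialL2 n) (k : ℕ) :
    (gegenbauerBasis hn).repr u k = (Real.sqrt (gegenbauerNormSq n k))⁻¹ *
      ∫ x, u x * (sphereGegenbauer n k).eval x ∂(axialMeasure n) := by
  rw [HilbertBasis.repr_apply_apply, gegenbauerBasis_apply, unitGegenbauer, real_inner_smul_left,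
    inner_polyL2_left]

/-- The functional calculus is diagonal in the Gegenbauer basis: an eigenfunction with eigenvalue
`m` has nonzero coefficients only where `laplaceEigenvalue n k = m`. -/
theorem isLaplacianFunction_iff {n : ℕ} (hn : 2 ≤ n) (g : ℝ → ℝ) (u f : AxialL2 n) :
    IsLaplacianFunction n g u f ↔ ∀ k, (gegenbauerBasis hn).repr f k =
      g (laplaceEigenvalue n k) * (gegenbauerBasis hn).repr u k := by
  constructor
  · intro h k
    rw [repr_gegenbauerBasis, repr_gegenbauerBasis, h _ _ (negLaplacian_sphereGegenbauer n k)]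
    ring
  · intro h φ m hφ
    rw [← inner_polyL2_left, ← inner_polyL2_left,
      ← (gegenbauerBasis hn).tsum_inner_mul_inner, ← (gegenbauerBasis hn).tsum_inner_mul_inner,
      ← tsum_mul_left]
    refine tsum_congr fun k => ?_
    simp only [← HilbertBasis.repr_apply_apply]
    rw [h k]
    have hsymm := polyIntegral_negLaplacian_mul hn (sphereGegenbauer n k) φ
    rw [negLaplacian_sphereGegenbauer, hφ, smul_mul_assoc, mul_smul_comm, map_smul, map_smul,
      smul_eq_mul, smul_eq_mul, ← sub_eq_zero, ← sub_mul, mul_eq_zero, sub_eq_zero] at hsymm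
    rcases hsymm with hm | h0
    · rw [hm]; ring
    · have : inner ℝ (polyL2 n φ) ((gegenbauerBasis hn) k) = 0 := by
        rw [gegenbauerBasis_apply, unitGegenbauer, real_inner_smul_right, inner_polyL2_polyL2,
          mul_comm φ, h0, mul_zero]
      rw [this]
      ring

theorem isPaneitz_iff {n : ℕ} (hn : 2 ≤ n) (u f : AxialL2 n) :
    IsPaneitz n u f ↔ ∀ k, (gegenbauerBasis hn).repr f k =
      eigenvalue n k * (gegenbauerBasis hn).repr u k := by
  rw [IsPaneitz, isLaplacianFunction_iff hn]
  simp only [paneitzSymbol_laplaceEigenvalue hn]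

theorem gegenbauerBasis_ext {n : ℕ} (hn : 2 ≤ n) {u v : AxialL2 n}
    (h : ∀ k, (gegenbauerBasis hn).repr u k = (gegenbauerBasis hn).repr v k) : u = v :=
  (gegenbauerBasis hn).repr.injective (lp.ext (funext h))

/-! ### Diagonal operators and estimates in the Gegenbauer basis -/

/-- Diagonal operators with bounded entries. -/
theorem exists_diagonal {H : Type*} [NormedAddCommGroup H] [InnerProductSpace ℝ H]
    (b : HilbertBasis ℕ ℝ H) (a : ℕ → ℝ) (M : ℝ) (ha : ∀ k, |a k| ≤ M) :
    ∃ T : H →L[ℝ] H, ∀ u k, b.repr (T u) k = a k * b.repr u k := by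
  have hM : 0 ≤ M := (abs_nonneg _).trans (ha 0)
  let D : lp (fun _ : ℕ => ℝ) 2 →L[ℝ] lp (fun _ : ℕ => ℝ) 2 :=
    lp.mapCLM 2 (fun k => a k • ContinuousLinearMap.id ℝ ℝ) hM fun k => by
      rw [norm_smul]
      simpa using ha k
  refine ⟨b.repr.symm.toContinuousLinearEquiv.toContinuousLinearMap ∘L D ∘L
    b.repr.toContinuousLinearEquiv.toContinuousLinearMap, fun u k => ?_⟩
  simp [D, lp.mapCLM]

/-- Cauchy–Schwarz: a sequence with square summable norms synthesizes `ℓ²`. -/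
theorem exists_synthesis {F : Type*} [NormedAddCommGroup F] [NormedSpace ℝ F] [CompleteSpace F]
    (b : ℕ → F) (hb : Summable fun k => ‖b k‖ ^ 2) :
    ∃ L : lp (fun _ : ℕ => ℝ) 2 →L[ℝ] F, ∀ f, HasSum (fun k => f k • b k) (L f) := by
  have hmem : Memℓp (fun k => ‖b k‖) 2 := memℓp_gen (by simpa using hb)
  let B : lp (fun _ : ℕ => ℝ) 2 := ⟨_, hmem⟩
  have hpq : (2 : ℝ≥0∞).toReal.HolderConjugate (2 : ℝ≥0∞).toReal := by
    simpa using Real.HolderConjugate.two_two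
  have hnorm : ∀ (f : lp (fun _ : ℕ => ℝ) 2) k, ‖f k • b k‖ = ‖f k‖ * ‖B k‖ := by
    intro f k
    rw [norm_smul]
    simp [B]
  have hsum : ∀ f : lp (fun _ : ℕ => ℝ) 2, Summable fun k => ‖f k • b k‖ := by
    intro f
    simp only [hnorm]
    exact lp.summable_mul hpq f B
  let L₀ : lp (fun _ : ℕ => ℝ) 2 →ₗ[ℝ] F :=
    { toFun := fun f => ∑' k, f k • b k
      map_add' := fun f g => by
        rw [← (hsum f).of_norm.tsum_add (hsum g).of_norm]
        simp only [lp.coeFn_add, Pi.add_apply, add_smul]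
      map_smul' := fun c f => by
        rw [RingHom.id_apply, ← (hsum f).of_norm.tsum_const_smul]
        simp only [lp.coeFn_smul, Pi.smul_apply, smul_assoc] }
  refine ⟨L₀.mkContinuous ‖B‖ fun f => ?_, fun f => (hsum f).of_norm.hasSum⟩
  refine (norm_tsum_le_tsum_norm (hsum f)).trans ?_
  simp only [hnorm]
  rw [mul_comm]
  exact lp.tsum_mul_le_mul_norm' hpq f B

/-- The factors of `k (k + 1) ⋯ (k + n - 1)` from the two ends, multiplied in pairs. -/
theorem eigenvalue_sq (n k : ℕ) : eigenvalue n k ^ 2 =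
    ∏ s ∈ Finset.range n, (laplaceEigenvalue n k + (s : ℝ) * ((n : ℝ) - 1 - s)) := by
  rw [sq]
  nth_rewrite 2 [eigenvalue]
  rw [← Finset.prod_range_reflect, eigenvalue, ← Finset.prod_mul_distrib]
  refine Finset.prod_congr rfl fun s hs => ?_
  have := Finset.mem_range.1 hs
  rw [Nat.cast_sub (by omega), Nat.cast_sub (by omega), laplaceEigenvalue]
  push_cast
  ring

theorem eigenvalue_sq_le {n : ℕ} (hn : 2 ≤ n) (k : ℕ) :
    eigenvalue n k ^ 2 ≤ ((n : ℝ) ^ 2) ^ n * (1 + laplaceEigenvalue n k) ^ n := by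
  have hn' : (2 : ℝ) ≤ n := by exact_mod_cast hn
  have hm := laplaceEigenvalue_nonneg hn k
  rw [eigenvalue_sq, ← mul_pow, show ((n : ℝ) ^ 2 * (1 + laplaceEigenvalue n k)) ^ n =
    ∏ s ∈ Finset.range n, ((n : ℝ) ^ 2 * (1 + laplaceEigenvalue n k)) by simp]
  refine Finset.prod_le_prod (fun s hs => ?_) fun s hs => ?_
  all_goals
    have h1 : ((s : ℝ) + 1) ≤ n := by exact_mod_cast Finset.mem_range.1 hs
    have h0 : (0 : ℝ) ≤ s := s.cast_nonneg
  · have : 0 ≤ (s : ℝ) * ((n : ℝ) - 1 - s) := mul_nonneg h0 (by linarith)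
    linarith
  · have h2 : (s : ℝ) * ((n : ℝ) - 1 - s) ≤ n * n :=
      mul_le_mul (by linarith) (by linarith) (by linarith) (by linarith)
    have h3 : 1 * laplaceEigenvalue n k ≤ (n : ℝ) ^ 2 * laplaceEigenvalue n k := by
      gcongr
      nlinarith
    linarith

theorem laplaceEigenvalue_pow_le {n : ℕ} (hn : 2 ≤ n) (k : ℕ) :
    laplaceEigenvalue n k ^ n ≤ eigenvalue n k ^ 2 := by
  have hm := laplaceEigenvalue_nonneg hn k
  rw [eigenvalue_sq, show laplaceEigenvalue n k ^ n =
    ∏ s ∈ Finset.range n, laplaceEigenvalue n k by simp]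
  refine Finset.prod_le_prod (fun s hs => hm) fun s hs => ?_
  have h1 : ((s : ℝ) + 1) ≤ n := by exact_mod_cast Finset.mem_range.1 hs
  have h0 : (0 : ℝ) ≤ s := s.cast_nonneg
  have : 0 ≤ (s : ℝ) * ((n : ℝ) - 1 - s) := mul_nonneg h0 (by linarith)
  linarith

theorem one_le_laplaceEigenvalue {n : ℕ} (hn : 2 ≤ n) {k : ℕ} (hk : 1 ≤ k) :
    1 ≤ laplaceEigenvalue n k := by
  have hn' : (2 : ℝ) ≤ n := by exact_mod_cast hn
  have hk' : (1 : ℝ) ≤ k := by exact_mod_cast hk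
  rw [laplaceEigenvalue]
  nlinarith

theorem le_eigenvalue {n : ℕ} (hn : 2 ≤ n) {k : ℕ} (hk : 1 ≤ k) : (k : ℝ) ≤ eigenvalue n k := by
  have hk' : (1 : ℝ) ≤ k := by exact_mod_cast hk
  obtain ⟨m, rfl⟩ : ∃ m, n = m + 1 := ⟨n - 1, by omega⟩
  rw [eigenvalue, Finset.prod_range_succ']
  have : (1 : ℝ) ≤ ∏ s ∈ Finset.range m, ((k : ℝ) + ((s + 1 : ℕ) : ℝ)) := by
    rw [← Finset.prod_const_one (s := Finset.range m)]
    refine Finset.prod_le_prod (fun _ _ => zero_le_one) fun s _ => ?_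
    have : (0 : ℝ) ≤ ((s + 1 : ℕ) : ℝ) := Nat.cast_nonneg _
    linarith
  push_cast at this ⊢
  nlinarith

/-- The symbol `(1 + t)^(n/2)` of `(1 - Δ)^(n/2)` at the eigenvalues. -/
noncomputable def sobolevWeight (n k : ℕ) : ℝ := (1 + laplaceEigenvalue n k) ^ ((n : ℝ) / 2)

theorem sobolevWeight_sq {n : ℕ} (hn : 2 ≤ n) (k : ℕ) :
    sobolevWeight n k ^ 2 = (1 + laplaceEigenvalue n k) ^ n := by
  have hm := laplaceEigenvalue_nonneg hn k
  rw [sobolevWeight, ← Real.rpow_mul_natCast (by linarith), ← Real.rpow_natCast]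
  congr 1
  push_cast
  ring

theorem sobolevWeight_pos {n : ℕ} (hn : 2 ≤ n) (k : ℕ) : 0 < sobolevWeight n k := by
  have hm := laplaceEigenvalue_nonneg hn k
  exact Real.rpow_pos_of_pos (by linarith) _

theorem abs_sobolevWeight_div_le {n : ℕ} (hn : 2 ≤ n) (k : ℕ) :
    |sobolevWeight n k / eigenvalue n k| ≤ 2 ^ n := by
  rcases Nat.eq_zero_or_pos k with rfl | hk
  · rw [eigenvalue_zero hn]; simp
  refine abs_le_of_sq_le_sq ?_ (by positivity)
  have h1 := one_le_laplaceEigenvalue hn hk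
  have h2 := eigenvalue_pos n hk
  rw [div_pow, sobolevWeight_sq hn, div_le_iff₀ (by positivity)]
  calc (1 + laplaceEigenvalue n k) ^ n ≤ (2 * laplaceEigenvalue n k) ^ n := by gcongr; linarith
    _ = 2 ^ n * laplaceEigenvalue n k ^ n := mul_pow _ _ _
    _ ≤ (2 ^ n) ^ 2 * eigenvalue n k ^ 2 := by
      gcongr
      · have : (1 : ℝ) ≤ 2 ^ n := one_le_pow₀ (by norm_num)
        nlinarith
      · exact laplaceEigenvalue_pow_le hn k

theorem abs_inv_eigenvalue_le {n : ℕ} (hn : 2 ≤ n) (k : ℕ) : |(eigenvalue n k)⁻¹| ≤ 1 := by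
  rcases Nat.eq_zero_or_pos k with rfl | hk
  · rw [eigenvalue_zero hn]; simp
  have h1 := le_eigenvalue hn hk
  have h2 : (1 : ℝ) ≤ k := by exact_mod_cast hk
  rw [abs_of_nonneg (inv_nonneg.2 (by linarith))]
  exact inv_le_one_of_one_le₀ (by linarith)

/-- The Gegenbauer polynomials, normalized in `H^n`, have square summable sup norms (the sup norm is
the value at `1`). The Sobolev embedding into the continuous functions rests on this. -/
theorem exists_sup_bound {n : ℕ} (hn : 2 ≤ n) : ∃ c : ℝ, ∀ k : ℕ, 1 ≤ k →
    (sphereGegenbauer n k).eval 1 ^ 2 / (sobolevWeight n k ^ 2 * gegenbauerNormSq n k) ≤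
      c / (k : ℝ) ^ 2 := by
  obtain ⟨α, hα⟩ := exists_gegenbauer_eval_one_sq hn
  have hn' : (2 : ℝ) ≤ n := by exact_mod_cast hn
  refine ⟨|α| * ((n : ℝ) ^ 2) ^ n, fun k hk => ?_⟩
  have hk' : (1 : ℝ) ≤ k := by exact_mod_cast hk
  have hh := gegenbauerNormSq_pos hn k
  have hw := sobolevWeight_pos hn k
  have hl := eigenvalue_pos n hk
  have hlk := le_eigenvalue hn hk
  have hmu := one_le_laplaceEigenvalue hn hk
  have h1 : eigenvalue n k ^ 2 ≤ ((n : ℝ) ^ 2) ^ n * sobolevWeight n k ^ 2 := by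
    rw [sobolevWeight_sq hn]
    exact eigenvalue_sq_le hn k
  have h2 : (sphereGegenbauer n k).eval 1 ^ 2 * k ≤
      |α| * eigenvalue n k * gegenbauerNormSq n k := by
    have h3 : (k : ℝ) + ((n : ℝ) - 1) / 2 ≤ k + n - 1 := by linarith
    have hpos : (0 : ℝ) < k + n - 1 := by linarith
    refine le_of_mul_le_mul_right ?_ hpos
    calc (sphereGegenbauer n k).eval 1 ^ 2 * k * (k + n - 1)
        = α * (k + ((n : ℝ) - 1) / 2) * eigenvalue n k * gegenbauerNormSq n k := by
          rw [← hα k hk, laplaceEigenvalue]; ring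
      _ ≤ |α| * (k + n - 1) * eigenvalue n k * gegenbauerNormSq n k := by
          gcongr
          · linarith
          · exact le_abs_self α
      _ = _ := by ring
  rw [div_le_div_iff₀ (by positivity) (by positivity)]
  calc (sphereGegenbauer n k).eval 1 ^ 2 * (k : ℝ) ^ 2
      = (sphereGegenbauer n k).eval 1 ^ 2 * k * k := by ring
    _ ≤ |α| * eigenvalue n k * gegenbauerNormSq n k * eigenvalue n k := by gcongr
    _ = |α| * gegenbauerNormSq n k * eigenvalue n k ^ 2 := by ring
    _ ≤ |α| * gegenbauerNormSq n k * (((n : ℝ) ^ 2) ^ n * sobolevWeight n k ^ 2) := by gcongr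
    _ = _ := by ring

/-- A polynomial on `[-1, 1]`, extended to a bounded continuous function on the line by the
constants `φ(±1)`. -/
noncomputable def clampPoly (φ : ℝ[X]) : BoundedContinuousFunction ℝ ℝ :=
  (BoundedContinuousFunction.mkOfCompact (φ.toContinuousMapOn (Icc (-1 : ℝ) 1))).compContinuous
    ⟨projIcc (-1 : ℝ) 1 (by norm_num), continuous_projIcc⟩

theorem clampPoly_apply (φ : ℝ[X]) {x : ℝ} (hx : x ∈ Icc (-1 : ℝ) 1) :
    clampPoly φ x = φ.eval x := by
  simp [clampPoly, projIcc_of_mem _ hx]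

theorem norm_clampPoly_le (φ : ℝ[X]) {M : ℝ} (hM : ∀ x ∈ Icc (-1 : ℝ) 1, |φ.eval x| ≤ M) :
    ‖clampPoly φ‖ ≤ M := by
  have h0 : 0 ≤ M := (abs_nonneg _).trans (hM 1 (by norm_num))
  refine (BoundedContinuousFunction.norm_le h0).2 fun x => ?_
  exact hM _ (projIcc (-1 : ℝ) 1 (by norm_num) x).2

theorem toLp_clampPoly (n : ℕ) (φ : ℝ[X]) :
    BoundedContinuousFunction.toLp 2 (axialMeasure n) ℝ (clampPoly φ) = polyL2 n φ := by
  refine Lp.ext ?_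
  filter_upwards [BoundedContinuousFunction.coeFn_toLp 2 (axialMeasure n) ℝ (clampPoly φ),
    coeFn_polyL2 n φ, ae_mem_axialMeasure n] with x h1 h2 hx
  rw [h1, h2, clampPoly_apply φ ⟨hx.1.le, hx.2.le⟩]

/-! ### The space `𝒱` -/

theorem mem_axialSobolev_iff {n : ℕ} (hn : 2 ≤ n) (p : WithLp 2 (AxialL2 n × AxialL2 n)) :
    p ∈ axialSobolev n ↔ (∀ k, (gegenbauerBasis hn).repr p.snd k =
      sobolevWeight n k * (gegenbauerBasis hn).repr p.fst k) ∧
        (gegenbauerBasis hn).repr p.fst 0 = 0 := by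
  change IsLaplacianFunction n (fun t => (1 + t) ^ ((n : ℝ) / 2)) p.fst p.snd ∧
    ∫ x, p.fst x ∂(axialMeasure n) = 0 ↔ _
  rw [isLaplacianFunction_iff hn, repr_gegenbauerBasis hn p.fst 0, sphereGegenbauer_zero]
  have := (Real.sqrt_pos.2 (gegenbauerNormSq_pos hn 0)).ne'
  simp [this, sobolevWeight]

theorem completeSpace_axialSobolev {n : ℕ} (hn : 2 ≤ n) : CompleteSpace (axialSobolev n) := by
  have hcont : ∀ k, Continuous fun u : AxialL2 n => (gegenbauerBasis hn).repr u k := fun k => by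
    simp only [HilbertBasis.repr_apply_apply]
    fun_prop
  have hfst : Continuous fun p : WithLp 2 (AxialL2 n × AxialL2 n) => p.fst :=
    WithLp.continuous_fst 2 _ _
  have hsnd : Continuous fun p : WithLp 2 (AxialL2 n × AxialL2 n) => p.snd :=
    WithLp.continuous_snd 2 _ _
  have hset : (axialSobolev n : Set (WithLp 2 (AxialL2 n × AxialL2 n))) =
      (⋂ k, {p | (gegenbauerBasis hn).repr p.snd k =
        sobolevWeight n k * (gegenbauerBasis hn).repr p.fst k}) ∩
          {p | (gegenbauerBasis hn).repr p.fst 0 = 0} := by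
    ext p
    simp [mem_axialSobolev_iff hn]
  have hclosed : IsClosed (axialSobolev n : Set (WithLp 2 (AxialL2 n × AxialL2 n))) := by
    rw [hset]
    refine (isClosed_iInter fun k => isClosed_eq ?_ ?_).inter (isClosed_eq ?_ continuous_const)
    · exact (hcont k).comp hsnd
    · exact continuous_const.mul ((hcont k).comp hfst)
    · exact (hcont 0).comp hfst
  exact hclosed.completeSpace_coe

/-- `toFn` as a continuous linear map. -/
noncomputable def toFnL (n : ℕ) : axialSobolev n →L[ℝ] AxialL2 n :=
  WithLp.fstL 2 ℝ _ _ ∘L (axialSobolev n).subtypeL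

theorem axialSobolev_ext {n : ℕ} (hn : 2 ≤ n) {u v : axialSobolev n}
    (h : ∀ k, (gegenbauerBasis hn).repr (toFn u) k = (gegenbauerBasis hn).repr (toFn v) k) :
    u = v := by
  have hu := ((mem_axialSobolev_iff hn u.1).1 u.2).1
  have hv := ((mem_axialSobolev_iff hn v.1).1 v.2).1
  have h1 : u.1.fst = v.1.fst := gegenbauerBasis_ext hn h
  have h2 : u.1.snd = v.1.snd := gegenbauerBasis_ext hn fun k => by rw [hu, hv, h1]
  exact Subtype.ext (WithLp.ofLp_injective 2 (Prod.ext h1 h2))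

theorem repr_toFn_zero {n : ℕ} (hn : 2 ≤ n) (v : axialSobolev n) :
    (gegenbauerBasis hn).repr (toFn v) 0 = 0 :=
  ((mem_axialSobolev_iff hn v.1).1 v.2).2

/-- The Green operator of `P_n`: it divides the `k`-th coefficient by `λ_k` and, by the convention
`x / 0 = 0`, removes the mean. -/
theorem exists_green {n : ℕ} (hn : 2 ≤ n) : ∃ T : AxialL2 n →L[ℝ] axialSobolev n, ∀ f k,
    (gegenbauerBasis hn).repr (toFn (T f)) k =
      (eigenvalue n k)⁻¹ * (gegenbauerBasis hn).repr f k := by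
  obtain ⟨D₁, h₁⟩ := exists_diagonal (gegenbauerBasis hn) _ _ (abs_inv_eigenvalue_le hn)
  obtain ⟨D₂, h₂⟩ := exists_diagonal (gegenbauerBasis hn) _ _ (abs_sobolevWeight_div_le hn)
  let S : AxialL2 n →L[ℝ] WithLp 2 (AxialL2 n × AxialL2 n) :=
    (WithLp.prodContinuousLinearEquiv 2 ℝ _ _).symm.toContinuousLinearMap ∘L D₁.prod D₂
  refine ⟨S.codRestrict (axialSobolev n) fun f => ?_, h₁⟩
  refine (mem_axialSobolev_iff hn _).2 ⟨fun k => ?_, ?_⟩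
  · change (gegenbauerBasis hn).repr (D₂ f) k =
      sobolevWeight n k * (gegenbauerBasis hn).repr (D₁ f) k
    rw [h₁, h₂]
    ring
  · change (gegenbauerBasis hn).repr (D₁ f) 0 = 0
    rw [h₁, eigenvalue_zero hn]
    simp

theorem exists_paneitz {n : ℕ} (hn : 2 ≤ n) (v : axialSobolev n) :
    ∃ f, IsPaneitz n (toFn v) f := by
  have hv := ((mem_axialSobolev_iff hn v.1).1 v.2).1
  have hb : ∀ k, |eigenvalue n k / sobolevWeight n k| ≤ (n : ℝ) ^ n := fun k => by
    have hw := sobolevWeight_pos hn k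
    refine abs_le_of_sq_le_sq ?_ (by positivity)
    rw [div_pow, div_le_iff₀ (by positivity), sobolevWeight_sq hn, ← pow_mul, mul_comm n 2,
      pow_mul]
    exact eigenvalue_sq_le hn k
  obtain ⟨D, h⟩ := exists_diagonal (gegenbauerBasis hn) _ _ hb
  refine ⟨D v.1.snd, (isPaneitz_iff hn _ _).2 fun k => ?_⟩
  rw [h, hv]
  have hw := (sobolevWeight_pos hn k).ne'
  change _ = _ * (gegenbauerBasis hn).repr v.1.fst k
  field_simp

/-- The diagonal operators with bounded entries on `𝒱`. -/
theorem exists_diagonal_axialSobolev {n : ℕ} (hn : 2 ≤ n) (a : ℕ → ℝ) (M : ℝ)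
    (ha : ∀ k, |a k| ≤ M) : ∃ T : axialSobolev n →L[ℝ] axialSobolev n, ∀ v k,
      (gegenbauerBasis hn).repr (toFn (T v)) k = a k * (gegenbauerBasis hn).repr (toFn v) k := by
  obtain ⟨D, h⟩ := exists_diagonal (gegenbauerBasis hn) a M ha
  let S : axialSobolev n →L[ℝ] WithLp 2 (AxialL2 n × AxialL2 n) :=
    (WithLp.prodContinuousLinearEquiv 2 ℝ _ _).symm.toContinuousLinearMap ∘L
      (D ∘L toFnL n).prod (D ∘L WithLp.sndL 2 ℝ _ _ ∘L (axialSobolev n).subtypeL)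
  refine ⟨S.codRestrict (axialSobolev n) fun v => ?_, fun v k => h _ _⟩
  have hv := (mem_axialSobolev_iff hn v.1).1 v.2
  refine (mem_axialSobolev_iff hn _).2 ⟨fun k => ?_, ?_⟩
  · change (gegenbauerBasis hn).repr (D v.1.snd) k =
      sobolevWeight n k * (gegenbauerBasis hn).repr (D v.1.fst) k
    rw [h, h, hv.1]
    ring
  · change (gegenbauerBasis hn).repr (D v.1.fst) 0 = 0
    rw [h, hv.2, mul_zero]

/-- The Sobolev embedding of `𝒱` into the bounded continuous functions. -/
theorem exists_embedding {n : ℕ} (hn : 2 ≤ n) :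
    ∃ J : axialSobolev n →L[ℝ] BoundedContinuousFunction ℝ ℝ, ∀ v,
      BoundedContinuousFunction.toLp 2 (axialMeasure n) ℝ (J v) = toFn v := by
  have hn' : (2 : ℝ) ≤ n := by exact_mod_cast hn
  set s : ℕ → ℝ := fun k => (sobolevWeight n k)⁻¹ * (Real.sqrt (gegenbauerNormSq n k))⁻¹ with hs
  set b : ℕ → BoundedContinuousFunction ℝ ℝ := fun k => s k • clampPoly (sphereGegenbauer n k)
    with hb
  have hsum : Summable fun k => ‖b k‖ ^ 2 := by
    obtain ⟨c, hc⟩ := exists_sup_bound hn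
    rw [← summable_nat_add_iff 1]
    refine Summable.of_nonneg_of_le (fun k => by positivity) (fun k => ?_)
      ((summable_nat_add_iff 1).2 ((Real.summable_one_div_nat_pow (p := 2)).2 one_lt_two |>.mul_left
        c))
    have hk : 1 ≤ k + 1 := by omega
    have hbound : ‖clampPoly (sphereGegenbauer n (k + 1))‖ ≤
        |(sphereGegenbauer n (k + 1)).eval 1| :=
      norm_clampPoly_le _ fun x hx =>
        sq_le_sq.1 (gegenbauer_abs_le (((n : ℝ) - 1) / 2) (by linarith) (k + 1) hk hx)
    have hw := sobolevWeight_pos hn (k + 1)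
    have hh := gegenbauerNormSq_pos hn (k + 1)
    calc ‖b (k + 1)‖ ^ 2 = s (k + 1) ^ 2 * ‖clampPoly (sphereGegenbauer n (k + 1))‖ ^ 2 := by
          rw [hb, norm_smul, mul_pow, Real.norm_eq_abs, sq_abs]
      _ ≤ s (k + 1) ^ 2 * |(sphereGegenbauer n (k + 1)).eval 1| ^ 2 := by gcongr
      _ = (sphereGegenbauer n (k + 1)).eval 1 ^ 2 /
          (sobolevWeight n (k + 1) ^ 2 * gegenbauerNormSq n (k + 1)) := by
        rw [sq_abs, hs]
        simp only
        rw [mul_pow, inv_pow, inv_pow, Real.sq_sqrt hh.le]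
        field_simp
      _ ≤ c / ((k + 1 : ℕ) : ℝ) ^ 2 := hc (k + 1) hk
      _ = _ := by ring
  obtain ⟨L, hL⟩ := exists_synthesis b hsum
  refine ⟨L ∘L (gegenbauerBasis hn).repr.toContinuousLinearEquiv.toContinuousLinearMap ∘L
    WithLp.sndL 2 ℝ _ _ ∘L (axialSobolev n).subtypeL, fun v => ?_⟩
  have hv := ((mem_axialSobolev_iff hn v.1).1 v.2).1
  have h1 := (hL ((gegenbauerBasis hn).repr v.1.snd)).mapL
    (BoundedContinuousFunction.toLp 2 (axialMeasure n) ℝ)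
  have h2 := (gegenbauerBasis hn).hasSum_repr v.1.fst
  refine h1.unique ?_
  convert! h2 using 2 with k
  have hw := (sobolevWeight_pos hn k).ne'
  rw [map_smul, hb, map_smul, toLp_clampPoly, hv, gegenbauerBasis_apply, unitGegenbauer, smul_smul,
    smul_smul]
  congr 1
  simp only [hs]
  field_simp

theorem repr_polyL2_sphereGegenbauer {n : ℕ} (hn : 2 ≤ n) (k j : ℕ) :
    (gegenbauerBasis hn).repr (polyL2 n (sphereGegenbauer n k)) j =
      if j = k then Real.sqrt (gegenbauerNormSq n k) else 0 := by
  rw [HilbertBasis.repr_apply_apply, gegenbauerBasis_apply, unitGegenbauer,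
    real_inner_smul_left, inner_polyL2_polyL2]
  split_ifs with h
  · subst h
    rw [← sq, ← gegenbauerNormSq, inv_mul_eq_div, Real.div_sqrt]
  · rw [polyIntegral_sphereGegenbauer_mul hn h, mul_zero]

/-- The Gegenbauer polynomials of positive degree belong to `𝒱`. -/
theorem exists_gegenbauer_mem {n : ℕ} (hn : 2 ≤ n) {k : ℕ} (hk : 1 ≤ k) :
    ∃ w : axialSobolev n, toFn w = polyL2 n (sphereGegenbauer n k) := by
  have hrepr := repr_polyL2_sphereGegenbauer hn k
  refine ⟨⟨WithLp.toLp 2 (polyL2 n (sphereGegenbauer n k),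
    sobolevWeight n k • polyL2 n (sphereGegenbauer n k)), ?_⟩, rfl⟩
  refine (mem_axialSobolev_iff hn _).2 ⟨fun j => ?_, ?_⟩
  · change (gegenbauerBasis hn).repr (sobolevWeight n k • polyL2 n (sphereGegenbauer n k)) j =
      sobolevWeight n j * (gegenbauerBasis hn).repr (polyL2 n (sphereGegenbauer n k)) j
    rw [map_smul, lp.coeFn_smul, Pi.smul_apply, hrepr, smul_eq_mul]
    split_ifs with h
    · rw [h]
    · simp
  · change (gegenbauerBasis hn).repr (polyL2 n (sphereGegenbauer n k)) 0 = 0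
    rw [hrepr, if_neg (by omega)]

/-! ### Bifurcation from a simple eigenvalue -/

section CrandallRabinowitz

open Filter

variable {E : Type*} [NormedAddCommGroup E] [NormedSpace ℝ E]

/-- `N(u) = M(1, u)` has derivative `A` at `0`: differentiate `N(ε z) = ε M(ε, z)` at `ε = 0`. -/
theorem hasFDerivAt_of_scaling {M : ℝ × E → E} (hM : ContDiff ℝ 1 M) {A : E →L[ℝ] E}
    (hM0 : ∀ z, M (0, z) = A z) (hM1 : ∀ (ε : ℝ) z, M (1, ε • z) = ε • M (ε, z)) :
    HasFDerivAt (fun u => M (1, u)) A 0 := by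
  have hG : DifferentiableAt ℝ (fun u => M (1, u)) 0 := by
    have : ContDiff ℝ 1 fun u => M (1, u) := by fun_prop
    exact (this.differentiable one_ne_zero) 0
  suffices h : fderiv ℝ (fun u => M (1, u)) 0 = A by
    rw [← h]
    exact hG.hasFDerivAt
  ext z
  have hz : HasDerivAt (fun ε : ℝ => ε • z) z 0 := by
    simpa using (hasDerivAt_id (0 : ℝ)).smul_const z
  have h1 : HasDerivAt (fun ε : ℝ => M (1, ε • z)) (fderiv ℝ (fun u => M (1, u)) 0 z) 0 := by
    have hG' : HasFDerivAt (fun u => M (1, u)) (fderiv ℝ (fun u => M (1, u)) 0)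
        ((0 : ℝ) • z) := by
      rw [zero_smul]
      exact hG.hasFDerivAt
    exact hG'.comp_hasDerivAt 0 hz
  have h2 : HasDerivAt (fun ε : ℝ => ε • M (ε, z)) (A z) 0 := by
    have h3 : DifferentiableAt ℝ (fun ε : ℝ => M (ε, z)) 0 := by
      have : ContDiff ℝ 1 fun ε : ℝ => M (ε, z) := by fun_prop
      exact (this.differentiable one_ne_zero) 0
    have h4 : HasDerivAt (fun ε : ℝ => ε • M (ε, z)) _ 0 :=
      (hasDerivAt_id (0 : ℝ)).smul h3.hasDerivAt
    simpa [hM0] using h4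
  simp only [hM1] at h1
  exact h1.unique h2

/-- Near a simple characteristic value, the component of a solution `u = ρ N(u)` in the complement
of the kernel is small compared to the component along the kernel. -/
theorem eventually_norm_complement_le {N : E → E} {A : E →L[ℝ] E} (hN : HasFDerivAt N A 0)
    (hN0 : N 0 = 0) {l : E →L[ℝ] ℝ} {w : E} {ρ₀ : ℝ} (hρ₀ : ρ₀ ≠ 0) (hlw : l w = 1)
    (hAw : A w = ρ₀⁻¹ • w) (hlA : ∀ z, l (A z) = ρ₀⁻¹ * l z) (B : E ≃L[ℝ] E)
    (hB : ∀ z, B z = z - ρ₀ • A z - (ρ₀⁻¹ * l z) • w) {κ : ℝ} (hκ : 0 < κ) :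
    ∀ᶠ p : ℝ × E in 𝓝 (ρ₀, 0), p.2 = p.1 • N p.2 → ‖p.2 - l p.2 • w‖ ≤ κ * |l p.2| := by
  set b : ℝ := ‖(B.symm : E →L[ℝ] E)‖ with hb
  set K : ℝ := 2 * b * (|ρ₀| + 1) * (1 + ‖l‖ * ‖w‖) with hK
  have hK0 : 0 ≤ K := by positivity
  obtain ⟨τ, hτ, hτ1, hτ2⟩ : ∃ τ : ℝ, 0 < τ ∧ K * τ ≤ 1 / 2 ∧ 2 * (K * τ * ‖w‖) ≤ κ := by
    refine ⟨min (1 / (2 * (K + 1))) (κ / (2 * (K + 1) * (‖w‖ + 1))), by positivity, ?_, ?_⟩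
    · calc K * min (1 / (2 * (K + 1))) (κ / (2 * (K + 1) * (‖w‖ + 1)))
          ≤ (K + 1) * (1 / (2 * (K + 1))) := by gcongr; linarith; exact min_le_left _ _
        _ = 1 / 2 := by field_simp
    · calc 2 * (K * min (1 / (2 * (K + 1))) (κ / (2 * (K + 1) * (‖w‖ + 1))) * ‖w‖)
          ≤ 2 * ((K + 1) * (κ / (2 * (K + 1) * (‖w‖ + 1))) * (‖w‖ + 1)) := by
            gcongr
            · linarith
            · exact min_le_right _ _
            · linarith
        _ = κ := by field_simp
  have hR : ∀ᶠ u : E in 𝓝 0, ‖N u - A u‖ ≤ τ * ‖u‖ := by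
    have := hN.isLittleO.def hτ
    simpa [hN0] using this
  have h1 : ∀ᶠ p : ℝ × E in 𝓝 (ρ₀, 0), ‖N p.2 - A p.2‖ ≤ τ * ‖p.2‖ :=
    (continuous_snd.tendsto (ρ₀, (0 : E))).eventually hR
  have h2 : ∀ᶠ p : ℝ × E in 𝓝 (ρ₀, 0), |p.1 - ρ₀| * (b * ‖A‖) < 1 / 2 := by
    have hc : Continuous fun p : ℝ × E => |p.1 - ρ₀| * (b * ‖A‖) := by fun_prop
    exact (hc.tendsto _).eventually_lt_const (by simp)
  have h3 : ∀ᶠ p : ℝ × E in 𝓝 (ρ₀, 0), |p.1| < |ρ₀| + 1 := by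
    have hc : Continuous fun p : ℝ × E => |p.1| := by fun_prop
    exact (hc.tendsto _).eventually_lt_const (by simp)
  filter_upwards [h1, h2, h3] with p h1 h2 h3 hp
  obtain ⟨ρ, u⟩ := p
  simp only at h1 h2 h3 hp ⊢
  set R := N u - A u with hRdef
  set η := u - l u • w with hη
  have hlη : l η = 0 := by simp [hη, hlw]
  have hNu : N u = A u + R := by rw [hRdef]; abel
  have hlu : l u = ρ * (ρ₀⁻¹ * l u + l R) := by
    conv_lhs => rw [hp, hNu]
    rw [map_smul, map_add, hlA, smul_eq_mul]
  have hAη : A η = A u - (l u * ρ₀⁻¹) • w := by rw [hη, map_sub, map_smul, hAw, smul_smul]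
  have hηeq : η = ρ • (A η + R - l R • w) := by
    calc η = ρ • (A u + R) - (ρ * (ρ₀⁻¹ * l u + l R)) • w := by rw [← hlu, ← hNu, ← hp]
      _ = ρ • (A η + R - l R • w) := by
        rw [hAη]
        module
  have hBη : B η = (ρ - ρ₀) • A η + ρ • (R - l R • w) := by
    rw [hB, hlη, mul_zero, zero_smul, sub_zero]
    nth_rewrite 1 [hηeq]
    module
  have hle : ‖η‖ ≤ b * (|ρ - ρ₀| * (‖A‖ * ‖η‖) + (|ρ₀| + 1) * ((1 + ‖l‖ * ‖w‖) * (τ * ‖u‖))) := by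
    calc ‖η‖ = ‖(B.symm : E →L[ℝ] E) (B η)‖ := by simp
      _ ≤ b * ‖B η‖ := ContinuousLinearMap.le_opNorm _ _
      _ ≤ _ := by
        gcongr
        rw [hBη]
        refine (norm_add_le _ _).trans ?_
        rw [norm_smul, norm_smul, Real.norm_eq_abs, Real.norm_eq_abs]
        have e1 : ‖A η‖ ≤ ‖A‖ * ‖η‖ := A.le_opNorm η
        have e2 : ‖R - l R • w‖ ≤ (1 + ‖l‖ * ‖w‖) * (τ * ‖u‖) := by
          calc ‖R - l R • w‖ ≤ ‖R‖ + ‖l R • w‖ := norm_sub_le _ _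
            _ ≤ ‖R‖ + ‖l‖ * ‖R‖ * ‖w‖ := by
              rw [norm_smul]
              gcongr
              exact l.le_opNorm R
            _ = (1 + ‖l‖ * ‖w‖) * ‖R‖ := by ring
            _ ≤ _ := by gcongr
        gcongr
  have hle2 : ‖η‖ ≤ K * τ * ‖u‖ := by
    have e1 : |ρ - ρ₀| * (b * ‖A‖) * ‖η‖ ≤ 1 / 2 * ‖η‖ := by gcongr
    rw [hK]
    linarith
  have hu : ‖u‖ ≤ |l u| * ‖w‖ + ‖η‖ := by
    calc ‖u‖ = ‖l u • w + η‖ := by rw [hη]; congr 1; abel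
      _ ≤ ‖l u • w‖ + ‖η‖ := norm_add_le _ _
      _ = _ := by rw [norm_smul, Real.norm_eq_abs]
  have e3 : K * τ * ‖u‖ ≤ K * τ * (|l u| * ‖w‖) + 1 / 2 * ‖η‖ := by
    calc K * τ * ‖u‖ ≤ K * τ * (|l u| * ‖w‖ + ‖η‖) := by gcongr
      _ = K * τ * (|l u| * ‖w‖) + K * τ * ‖η‖ := by ring
      _ ≤ _ := by gcongr
  have e4 : 2 * (K * τ * ‖w‖) * |l u| ≤ κ * |l u| := by gcongr
  linarith

/-- The theorem of Crandall and Rabinowitz on bifurcation from a simple eigenvalue, for equations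
`u = ρ N(u)` with `N(u) = M(1, u)` and `M(ε, z) = N(εz) / ε`.  The hypothesis on `B` says that
`1 - ρ₀ A` is invertible on the complement `ker l` of its kernel, which is spanned by `w`. -/
theorem crandall_rabinowitz [CompleteSpace E] {M : ℝ × E → E} (hM : ContDiff ℝ 1 M)
    {A : E →L[ℝ] E} (hM0 : ∀ z, M (0, z) = A z)
    (hM1 : ∀ (ε : ℝ) z, M (1, ε • z) = ε • M (ε, z))
    {l : E →L[ℝ] ℝ} {w : E} {ρ₀ : ℝ} (hρ₀ : ρ₀ ≠ 0) (hlw : l w = 1)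
    (hAw : A w = ρ₀⁻¹ • w) (hlA : ∀ z, l (A z) = ρ₀⁻¹ * l z) (B : E ≃L[ℝ] E)
    (hB : ∀ z, B z = z - ρ₀ • A z - (ρ₀⁻¹ * l z) • w)
    {d : E} (hd : HasDerivAt (fun ε : ℝ => M (ε, w)) d 0) :
    ∃ (ε₀ : ℝ) (r : ℝ → ℝ) (ψ : ℝ → E), 0 < ε₀ ∧
      ContDiffOn ℝ 1 r (Ioo (-ε₀) ε₀) ∧ ContDiffOn ℝ 1 ψ (Ioo (-ε₀) ε₀) ∧
      r 0 = ρ₀ ∧ ψ 0 = 0 ∧ (∀ ε ∈ Ioo (-ε₀) ε₀, l (ψ ε) = 0) ∧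
      (∃ U : Set (ℝ × E), IsOpen U ∧ (ρ₀, 0) ∈ U ∧
        {p : ℝ × E | p.2 = p.1 • M (1, p.2) ∧ p.2 ≠ 0} ∩ U =
          {p | ∃ ε ∈ Ioo (-ε₀) ε₀, ε ≠ 0 ∧ p = (r ε, ε • w + ε • ψ ε)}) ∧
      HasDerivAt r (-ρ₀ ^ 2 * l d) 0 := by
  -- The unknown `z` encodes `ρ = ρ₀ + l z` and the component `z - l z • w` in `ker l`.
  set H : ℝ × E → E := fun p =>
    w + (p.2 - l p.2 • w) - (ρ₀ + l p.2) • M (p.1, w + (p.2 - l p.2 • w)) with hH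
  have hHc : ContDiff ℝ 1 H := by
    rw [hH]
    fun_prop
  have hHd : DifferentiableAt ℝ H (0, 0) := (hHc.differentiable one_ne_zero) _
  have hH00 : H (0, 0) = 0 := by simp [hH, hM0, hAw, hρ₀]
  have hinr : fderiv ℝ H (0, 0) ∘L .inr ℝ ℝ E = (B : E →L[ℝ] E) := by
    have h1 : HasFDerivAt (fun z : E => H (0, z)) (fderiv ℝ H (0, 0) ∘L .inr ℝ ℝ E) 0 :=
      HasFDerivAt.comp (0 : E) hHd.hasFDerivAt (hasFDerivAt_prodMk_right (0 : ℝ) (0 : E))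
    have h2 : HasFDerivAt (fun z : E => (B : E →L[ℝ] E) z - l z • A (z - l z • w))
        (B : E →L[ℝ] E) 0 := by
      have hl0 : HasFDerivAt (fun z : E => l z) l 0 := l.hasFDerivAt
      have hA0 : HasFDerivAt (fun z : E => A (z - l z • w))
          (A ∘L (ContinuousLinearMap.id ℝ E - l.smulRight w)) 0 :=
        (A ∘L (ContinuousLinearMap.id ℝ E - l.smulRight w)).hasFDerivAt
      have h3 := (B : E →L[ℝ] E).hasFDerivAt (x := 0) |>.sub (hl0.smul hA0)
      refine h3.congr_fderiv ?_
      ext z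
      simp
    refine h1.unique (h2.congr_of_eventuallyEq (Eventually.of_forall fun z => ?_))
    simp only [hH, hM0, ContinuousLinearEquiv.coe_coe, hB, map_add, map_sub, map_smul, hAw]
    have e : ρ₀ • ρ₀⁻¹ • w = w := by rw [smul_smul, mul_inv_cancel₀ hρ₀, one_smul]
    linear_combination (norm := module) (l z - 1) • e
  have hinl : fderiv ℝ H (0, 0) (1, 0) = -ρ₀ • d := by
    have h1 : HasDerivAt (fun ε : ℝ => H (ε, 0)) (fderiv ℝ H (0, 0) (1, 0)) 0 := by
      have h3 : HasDerivAt (fun ε : ℝ => (ε, (0 : E))) (1, 0) 0 :=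
        (hasDerivAt_id (0 : ℝ)).prodMk (hasDerivAt_const _ _)
      exact HasFDerivAt.comp_hasDerivAt (0 : ℝ) (f := fun ε : ℝ => (ε, (0 : E)))
        hHd.hasFDerivAt h3
    have h2 : HasDerivAt (fun ε : ℝ => H (ε, 0)) (-ρ₀ • d) 0 := by
      have h3 := (hd.const_smul ρ₀).const_sub w
      rw [← neg_smul] at h3
      refine h3.congr_of_eventuallyEq (Eventually.of_forall fun ε => ?_)
      simp [hH]
    exact h1.unique h2
  have hinv : (fderiv ℝ H (0, 0) ∘L .inr ℝ ℝ E).IsInvertible := hinr ▸ ⟨B, rfl⟩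
  have hHa : ContDiffAt ℝ 1 H (0, 0) := hHc.contDiffAt
  set ζ : ℝ → E := hHa.implicitFunction one_ne_zero hinv with hζ
  have hζ0 : ζ 0 = 0 := hHa.implicitFunction_apply_self one_ne_zero hinv
  have hζc : ContDiffAt ℝ 1 ζ 0 := hHa.contDiffAt_implicitFunction one_ne_zero hinv
  have hζH : ∀ᶠ ε in 𝓝 (0 : ℝ), H (ε, ζ ε) = 0 := by
    simpa only [hH00] using hHa.eventually_apply_implicitFunction one_ne_zero hinv
  have hζu : ∀ᶠ v in 𝓝 ((0 : ℝ), (0 : E)), H v = 0 ↔ ζ v.1 = v.2 := by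
    simpa only [hH00] using hHa.eventually_apply_eq_iff_implicitFunction one_ne_zero hinv
  have hlB : ∀ y, l (B.symm y) = -ρ₀ * l y := by
    intro y
    have h := hB (B.symm y)
    rw [B.apply_symm_apply] at h
    have h2 := congrArg l h
    simp only [map_sub, map_smul, hlA, hlw, smul_eq_mul] at h2
    rw [h2]
    field_simp
    ring
  have hζd : HasDerivAt (fun ε => ρ₀ + l (ζ ε)) (-ρ₀ ^ 2 * l d) 0 := by
    have h1 := (hHa.hasStrictFDerivAt_implicitFunction one_ne_zero hinv).hasFDerivAt.hasDerivAt
    have h2 := (l.hasFDerivAt.comp_hasDerivAt (0 : ℝ) h1).const_add ρ₀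
    refine h2.congr_deriv ?_
    rw [hinr]
    simp only [ContinuousLinearMap.comp_apply, neg_apply,
      ContinuousLinearMap.inl_apply, hinl, ContinuousLinearMap.inverse_equiv, map_neg, map_smul,
      ContinuousLinearEquiv.coe_coe, hlB, smul_eq_mul]
    ring
  -- A small solution `(ρ, u)` with `l u ≠ 0` comes from a small zero of `H`.
  obtain ⟨δ, hδ, hδu⟩ := Metric.eventually_nhds_iff.1 hζu
  have hκ : 0 < δ / 2 := by positivity
  have hcompl := eventually_norm_complement_le (hasFDerivAt_of_scaling hM hM0 hM1)
    (by simpa using hM1 0 0) hρ₀ hlw hAw hlA B hB hκ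
  have hnear1 : ∀ᶠ p : ℝ × E in 𝓝 (ρ₀, 0), |p.1 - ρ₀| * ‖w‖ < δ / 2 := by
    have hc : Continuous fun p : ℝ × E => |p.1 - ρ₀| * ‖w‖ := by fun_prop
    exact (hc.tendsto _).eventually_lt_const (by simpa using hδ)
  have hnear2 : ∀ᶠ p : ℝ × E in 𝓝 (ρ₀, 0), |l p.2| < δ := by
    have hc : Continuous fun p : ℝ × E => |l p.2| := by fun_prop
    exact (hc.tendsto _).eventually_lt_const (by simpa using hδ)
  obtain ⟨U₀, hU₀, hU₀o, hU₀m⟩ :=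
    mem_nhds_iff.1 (inter_mem (inter_mem hcompl hnear1) hnear2)
  have hcurve : ContinuousAt
      (fun ε : ℝ => ((ρ₀ + l (ζ ε), ε • w + ε • (ζ ε - l (ζ ε) • w)) : ℝ × E)) 0 := by
    have := hζc.continuousAt
    fun_prop
  have hcurveU : ∀ᶠ ε : ℝ in 𝓝 0,
      ((ρ₀ + l (ζ ε), ε • w + ε • (ζ ε - l (ζ ε) • w)) : ℝ × E) ∈ U₀ := by
    refine hcurve.eventually_mem (hU₀o.mem_nhds ?_)
    simpa [hζ0] using hU₀m
  obtain ⟨ε₀, hε₀, hε⟩ := Metric.eventually_nhds_iff.1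
    ((hζc.eventually (by simp)).and (hζH.and hcurveU))
  have hε' : ∀ ε ∈ Ioo (-ε₀) ε₀, ContDiffAt ℝ 1 ζ ε ∧ H (ε, ζ ε) = 0 ∧
      ((ρ₀ + l (ζ ε), ε • w + ε • (ζ ε - l (ζ ε) • w)) : ℝ × E) ∈ U₀ := fun ε h =>
    hε (by rw [Real.dist_eq, sub_zero]; exact abs_lt.2 h)
  refine ⟨ε₀, fun ε => ρ₀ + l (ζ ε), fun ε => ζ ε - l (ζ ε) • w, hε₀, ?_, ?_, ?_, ?_, ?_,
    ⟨U₀ ∩ {p | |l p.2| < ε₀}, ?_, ?_, ?_⟩, hζd⟩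
  · intro ε h
    have := (hε' ε h).1
    exact ContDiffAt.contDiffWithinAt (by fun_prop)
  · intro ε h
    have := (hε' ε h).1
    exact ContDiffAt.contDiffWithinAt (by fun_prop)
  · simp [hζ0]
  · simp [hζ0]
  · intro ε _
    simp [hlw]
  · exact hU₀o.inter (isOpen_lt (by fun_prop) continuous_const)
  · exact ⟨hU₀m, by simpa using hε₀⟩
  · ext ⟨ρ, u⟩
    constructor
    · rintro ⟨⟨hsol, hne⟩, hU, hlt⟩
      obtain ⟨⟨hc, hn1⟩, hn2⟩ := hU₀ hU
      simp only [mem_ofPred_eq] at hsol hne hlt hc hn1 hn2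
      replace hc := hc hsol
      have hl0 : l u ≠ 0 := by
        intro h0
        rw [h0, abs_zero, mul_zero, zero_smul, sub_zero] at hc
        exact hne (norm_le_zero_iff.1 hc)
      set ε := l u with hεdef
      set η : E := ε⁻¹ • (u - ε • w) with hη
      have hεη : u = ε • (w + η) := by
        rw [hη, smul_add, smul_smul, mul_inv_cancel₀ hl0, one_smul]
        abel
      have hηn : ‖η‖ ≤ δ / 2 := by
        rw [hη, norm_smul, norm_inv, Real.norm_eq_abs, inv_mul_le_iff₀ (abs_pos.2 hl0)]
        linarith
      have hlη : l η = 0 := by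
        rw [hη, map_smul, map_sub, map_smul, hlw, ← hεdef]
        simp
      set z : E := (ρ - ρ₀) • w + η with hz
      have hlz : l z = ρ - ρ₀ := by simp [hz, hlη, hlw]
      have hzη : z - l z • w = η := by rw [hlz, hz]; abel
      have hzn : ‖z‖ < δ := by
        calc ‖z‖ ≤ ‖(ρ - ρ₀) • w‖ + ‖η‖ := norm_add_le _ _
          _ < δ := by rw [norm_smul, Real.norm_eq_abs]; linarith
      have hHz : H (ε, z) = 0 := by
        have h1 : ε • H (ε, z) = 0 := by
          have h2 : H (ε, z) = w + η - ρ • M (ε, w + η) := by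
            simp only [hH]
            rw [hzη, hlz, add_sub_cancel]
          rw [h2, smul_sub, ← hεη, smul_comm, ← hM1, ← hεη, ← hsol, sub_self]
        exact (smul_eq_zero.1 h1).resolve_left hl0
      have hζz : ζ ε = z := by
        refine (hδu ?_).1 hHz
        rw [dist_eq_norm, Prod.norm_def]
        simpa using ⟨hn2, hzn⟩
      refine ⟨ε, abs_lt.1 hlt, hl0, ?_⟩
      change (ρ, u) = (ρ₀ + l (ζ ε), ε • w + ε • (ζ ε - l (ζ ε) • w))
      rw [hζz, hzη, hlz, add_sub_cancel, ← smul_add, ← hεη]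
    · rintro ⟨ε, hεm, hε0, hp⟩
      obtain ⟨_, hHε, hUε⟩ := hε' ε hεm
      rw [hp]
      set η : E := ζ ε - l (ζ ε) • w with hη
      have hlu : l (ε • w + ε • η) = ε := by simp [hη, hlw]
      refine ⟨⟨?_, ?_⟩, hUε, ?_⟩
      · simp only [hH, ← hη] at hHε
        simp only
        rw [← smul_add, hM1, smul_comm, ← sub_eq_zero, ← smul_sub, hHε, smul_zero]
      · intro h0
        simp only at h0
        rw [h0, map_zero] at hlu
        exact hε0 hlu.symm
      · change |l (ε • w + ε • η)| < ε₀
        rw [hlu]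
        exact abs_lt.2 hεm

end CrandallRabinowitz

/-! ### The exponential on bounded continuous functions -/

section ExpQuot

open Filter

variable {A : Type*} [NormedCommRing A] [NormedAlgebra ℝ A]

/-- The entire function `(eᵃ - 1) / a = ∑ aᵐ / (m + 1)!` on a Banach algebra. -/
noncomputable def expQuot (a : A) : A :=
  FormalMultilinearSeries.ofScalarsSum (𝕜 := ℝ) (fun m => ((m + 1).factorial : ℝ)⁻¹) a

theorem expQuot_zero : expQuot (0 : A) = 1 := by
  simp [expQuot, FormalMultilinearSeries.ofScalarsSum_zero]

theorem radius_expQuot : (FormalMultilinearSeries.ofScalars (𝕜 := ℝ) A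
    fun m => ((m + 1).factorial : ℝ)⁻¹).radius = ⊤ := by
  refine FormalMultilinearSeries.ofScalars_radius_eq_top_of_tendsto _ _
    (Eventually.of_forall fun m => by positivity) ?_
  have h : ∀ m : ℕ, ‖(((m.succ + 1).factorial : ℝ))⁻¹‖ / ‖((m + 1).factorial : ℝ)⁻¹‖ =
      1 / ((m + 1 : ℕ) + 1 : ℝ) := fun m => by
    rw [Nat.succ_eq_add_one, Nat.factorial_succ (m + 1), norm_inv, norm_inv, Real.norm_natCast,
      Real.norm_natCast]
    push_cast
    field_simp
  simp only [h]
  exact (tendsto_add_atTop_iff_nat (f := fun m : ℕ => 1 / ((m : ℝ) + 1)) 1).2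
    tendsto_one_div_add_atTop_nhds_zero_nat

theorem hasFPowerSeriesOnBall_expQuot [CompleteSpace A] :
    HasFPowerSeriesOnBall (expQuot : A → A) (FormalMultilinearSeries.ofScalars (𝕜 := ℝ) A
      fun m => ((m + 1).factorial : ℝ)⁻¹) 0 ⊤ := by
  have h := (FormalMultilinearSeries.ofScalars (𝕜 := ℝ) A
    fun m => ((m + 1).factorial : ℝ)⁻¹).hasFPowerSeriesOnBall (by rw [radius_expQuot]; simp)
  rwa [radius_expQuot] at h

theorem contDiff_expQuot [CompleteSpace A] {m : ℕ∞ω} : ContDiff ℝ m (expQuot : A → A) := by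
  refine AnalyticOnNhd.contDiff fun a _ => hasFPowerSeriesOnBall_expQuot.analyticAt_of_mem ?_
  simp

theorem hasFDerivAt_expQuot_zero [CompleteSpace A] :
    HasFDerivAt (expQuot : A → A) ((2⁻¹ : ℝ) • ContinuousLinearMap.id ℝ A) 0 := by
  refine hasFPowerSeriesOnBall_expQuot.hasFPowerSeriesAt.hasStrictFDerivAt.hasFDerivAt.congr_fderiv
    ?_
  ext a
  have h := FormalMultilinearSeries.ofScalars_apply_eq
    (fun m => ((m + 1).factorial : ℝ)⁻¹) a 1
  simp only [pow_one] at h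
  rw [continuousMultilinearCurryFin1_apply]
  convert! h using 1

end ExpQuot

theorem mul_expQuot_apply (a : BoundedContinuousFunction ℝ ℝ) (x : ℝ) :
    a x * expQuot a x = Real.exp (a x) - 1 := by
  have h1 := hasFPowerSeriesOnBall_expQuot.hasSum (y := a) (by simp)
  rw [zero_add] at h1
  have h2 := (h1.mapL (BoundedContinuousFunction.evalCLM ℝ x)).mul_left (a x)
  have h3 := (hasSum_nat_add_iff' 1).2 (NormedSpace.expSeries_div_hasSum_exp (a x))
  rw [← Real.exp_eq_exp_ℝ] at h3
  simp only [Finset.range_one, Finset.sum_singleton, pow_zero, Nat.factorial_zero, Nat.cast_one,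
    div_one] at h3
  refine h2.unique ?_
  convert! h3 using 2 with m
  rw [FormalMultilinearSeries.ofScalars_apply_eq]
  simp only [BoundedContinuousFunction.evalCLM_apply, BoundedContinuousFunction.coe_smul,
    BoundedContinuousFunction.coe_pow, Pi.pow_apply, smul_eq_mul]
  rw [pow_succ]
  ring

/-- Integration of bounded continuous functions against `axialMeasure n`. -/
noncomputable def bcfIntegral (n : ℕ) : BoundedContinuousFunction ℝ ℝ →L[ℝ] ℝ :=
  innerSL ℝ (polyL2 n 1) ∘L BoundedContinuousFunction.toLp 2 (axialMeasure n) ℝ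

theorem bcfIntegral_apply (n : ℕ) (a : BoundedContinuousFunction ℝ ℝ) :
    bcfIntegral n a = ∫ x, a x ∂(axialMeasure n) := by
  rw [bcfIntegral, ContinuousLinearMap.comp_apply, innerSL_apply_apply, inner_polyL2_left]
  refine integral_congr_ae ?_
  filter_upwards [BoundedContinuousFunction.coeFn_toLp 2 (axialMeasure n) ℝ a] with x hx
  rw [hx, eval_one, mul_one]

theorem bcfIntegral_one {n : ℕ} (hn : 2 ≤ n) : bcfIntegral n 1 = sphereConst n := by
  rw [bcfIntegral_apply, ← polyIntegral_one hn, polyIntegral_apply]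
  simp

/-- The integral of `eᵃ`, written as `1 + a (eᵃ - 1) / a`. -/
noncomputable def expIntegral (n : ℕ) (a : BoundedContinuousFunction ℝ ℝ) : ℝ :=
  bcfIntegral n (1 + a * expQuot a)

theorem expIntegral_eq (n : ℕ) (a : BoundedContinuousFunction ℝ ℝ) :
    expIntegral n a = ∫ x, Real.exp (a x) ∂(axialMeasure n) := by
  rw [expIntegral, bcfIntegral_apply]
  refine integral_congr_ae (Filter.Eventually.of_forall fun x => ?_)
  simp [mul_expQuot_apply]

theorem expIntegral_pos {n : ℕ} (hn : 2 ≤ n) (a : BoundedContinuousFunction ℝ ℝ) :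
    0 < expIntegral n a := by
  have hne : NeZero (axialMeasure n) := ⟨fun h => by
    have := polyIntegral_one hn
    rw [polyIntegral_apply, h, integral_zero_measure] at this
    exact (sphereConst_pos hn).ne this⟩
  rw [expIntegral_eq]
  refine integral_exp_pos ?_
  refine Integrable.of_bound (C := Real.exp ‖a‖) (by fun_prop)
    (Filter.Eventually.of_forall fun x => ?_)
  rw [Real.norm_eq_abs, Real.abs_exp]
  exact Real.exp_le_exp.2 ((le_abs_self _).trans (a.norm_coe_le_norm x))

theorem contDiff_expIntegral (n : ℕ) : ContDiff ℝ 1 (expIntegral n) :=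
  (bcfIntegral n).contDiff.comp (contDiff_const.add (contDiff_id.mul contDiff_expQuot))

/-! ### The equation as a fixed point problem -/

/-- The Green operator of `P_n`, from `L²` to `𝒱`. -/
noncomputable def green {n : ℕ} (hn : 2 ≤ n) : AxialL2 n →L[ℝ] axialSobolev n :=
  (exists_green hn).choose

theorem repr_green {n : ℕ} (hn : 2 ≤ n) (f : AxialL2 n) (k : ℕ) :
    (gegenbauerBasis hn).repr (toFn (green hn f)) k =
      (eigenvalue n k)⁻¹ * (gegenbauerBasis hn).repr f k :=
  (exists_green hn).choose_spec f k

/-- The embedding of `𝒱` into the bounded continuous functions. -/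
noncomputable def embedding {n : ℕ} (hn : 2 ≤ n) :
    axialSobolev n →L[ℝ] BoundedContinuousFunction ℝ ℝ :=
  (exists_embedding hn).choose

theorem toLp_embedding {n : ℕ} (hn : 2 ≤ n) (v : axialSobolev n) :
    BoundedContinuousFunction.toLp 2 (axialMeasure n) ℝ (embedding hn v) = toFn v :=
  (exists_embedding hn).choose_spec v

theorem embedding_ae_eq {n : ℕ} (hn : 2 ≤ n) (v : axialSobolev n) :
    toFn v =ᵐ[axialMeasure n] embedding hn v := by
  rw [← toLp_embedding hn v]
  exact BoundedContinuousFunction.coeFn_toLp 2 (axialMeasure n) ℝ (embedding hn v)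

theorem integral_exp_toFn {n : ℕ} (hn : 2 ≤ n) (v : axialSobolev n) :
    ∫ x, Real.exp (n * toFn v x) ∂(axialMeasure n) =
      expIntegral n ((n : ℝ) • embedding hn v) := by
  rw [expIntegral_eq]
  refine integral_congr_ae ?_
  filter_upwards [embedding_ae_eq hn v] with x hx
  rw [hx]
  simp

/-- With `N(u)` the Green operator applied to `e^{nu} / ∫ e^{nu} dw`, so that the equation is
`u = ρ N(u)`, this is `(ε, z) ↦ N(ε z) / ε`, continued to `ε = 0`.  It uses that the Green operator
annihilates the `1` in `e^{nεz} = 1 + nεz (e^{nεz} - 1) / (nεz)`. -/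
noncomputable def blowup {n : ℕ} (hn : 2 ≤ n) (p : ℝ × axialSobolev n) : axialSobolev n :=
  (expIntegral n (((n : ℝ) * p.1) • embedding hn p.2))⁻¹ •
    green hn (BoundedContinuousFunction.toLp 2 (axialMeasure n) ℝ
      (((n : ℝ) * sphereConst n) •
        (embedding hn p.2 * expQuot (((n : ℝ) * p.1) • embedding hn p.2))))

theorem contDiff_blowup {n : ℕ} (hn : 2 ≤ n) : ContDiff ℝ 1 (blowup hn) := by
  have h1 : ContDiff ℝ 1 fun p : ℝ × axialSobolev n => ((n : ℝ) * p.1) • embedding hn p.2 := by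
    fun_prop
  have h2 : ContDiff ℝ 1 fun p : ℝ × axialSobolev n =>
      expQuot (((n : ℝ) * p.1) • embedding hn p.2) := contDiff_expQuot.comp h1
  have h3 := (contDiff_expIntegral n).comp h1
  have h4 : ContDiff ℝ 1 fun p : ℝ × axialSobolev n => embedding hn p.2 := by fun_prop
  have h5 : ContDiff ℝ 1 (green hn ∘L BoundedContinuousFunction.toLp 2 (axialMeasure n) ℝ) :=
    ContinuousLinearMap.contDiff _
  exact (h3.inv fun p => (expIntegral_pos hn _).ne').smul
    (h5.comp ((h4.mul h2).const_smul ((n : ℝ) * sphereConst n)))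

theorem blowup_smul {n : ℕ} (hn : 2 ≤ n) (ε : ℝ) (z : axialSobolev n) :
    blowup hn (1, ε • z) = ε • blowup hn (ε, z) := by
  have h : ((n : ℝ) * 1) • embedding hn (ε • z) = ((n : ℝ) * ε) • embedding hn z := by
    rw [map_smul, smul_smul, mul_one]
  simp only [blowup, h]
  rw [map_smul (embedding hn), smul_mul_assoc, smul_comm _ ε, map_smul _ ε, map_smul _ ε,
    smul_comm _ ε]

/-- The linearization of `u ↦ N(u)` at `0`. -/
noncomputable def linearization {n : ℕ} (hn : 2 ≤ n) : axialSobolev n →L[ℝ] axialSobolev n :=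
  (n : ℝ) • green hn ∘L toFnL n

theorem repr_linearization {n : ℕ} (hn : 2 ≤ n) (z : axialSobolev n) (k : ℕ) :
    (gegenbauerBasis hn).repr (toFn (linearization hn z)) k =
      n * (eigenvalue n k)⁻¹ * (gegenbauerBasis hn).repr (toFn z) k := by
  have h : toFn (linearization hn z) = (n : ℝ) • toFn (green hn (toFn z)) := rfl
  rw [h, map_smul, lp.coeFn_smul, Pi.smul_apply, repr_green, smul_eq_mul, mul_assoc]

theorem expIntegral_zero {n : ℕ} (hn : 2 ≤ n) : expIntegral n 0 = sphereConst n := by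
  rw [expIntegral, zero_mul, add_zero, bcfIntegral_one hn]

theorem blowup_zero {n : ℕ} (hn : 2 ≤ n) (z : axialSobolev n) :
    blowup hn (0, z) = linearization hn z := by
  have hc := (sphereConst_pos hn).ne'
  simp only [blowup, mul_zero, zero_smul, expQuot_zero, mul_one, expIntegral_zero hn]
  rw [map_smul, toLp_embedding, map_smul, smul_smul, mul_comm (n : ℝ), inv_mul_cancel_left₀ hc]
  rfl

theorem toLp_one (n : ℕ) :
    BoundedContinuousFunction.toLp 2 (axialMeasure n) ℝ 1 = polyL2 n (sphereGegenbauer n 0) := by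
  refine Lp.ext ?_
  filter_upwards [BoundedContinuousFunction.coeFn_toLp 2 (axialMeasure n) ℝ
    (1 : BoundedContinuousFunction ℝ ℝ),
    coeFn_polyL2 n (sphereGegenbauer n 0)] with x h1 h2
  rw [h1, h2, sphereGegenbauer_zero]
  simp

theorem repr_toLp_one {n : ℕ} (hn : 2 ≤ n) {k : ℕ} (hk : k ≠ 0) : (gegenbauerBasis hn).repr
    (BoundedContinuousFunction.toLp 2 (axialMeasure n) ℝ 1) k = 0 := by
  rw [toLp_one, repr_polyL2_sphereGegenbauer, if_neg hk]

theorem repr_toLp_zero {n : ℕ} (hn : 2 ≤ n) (a : BoundedContinuousFunction ℝ ℝ) :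
    (gegenbauerBasis hn).repr (BoundedContinuousFunction.toLp 2 (axialMeasure n) ℝ a) 0 =
      (Real.sqrt (gegenbauerNormSq n 0))⁻¹ * bcfIntegral n a := by
  rw [repr_gegenbauerBasis, bcfIntegral_apply]
  congr 1
  refine integral_congr_ae ?_
  filter_upwards [BoundedContinuousFunction.coeFn_toLp 2 (axialMeasure n) ℝ a] with x hx
  rw [hx, sphereGegenbauer_zero, eval_one, mul_one]

/-- The right-hand side of the equation, as an element of `L²`. -/
noncomputable def rightSide {n : ℕ} (hn : 2 ≤ n) (v : axialSobolev n) : AxialL2 n :=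
  BoundedContinuousFunction.toLp 2 (axialMeasure n) ℝ
    ((sphereConst n / expIntegral n ((n : ℝ) • embedding hn v)) •
      (1 + ((n : ℝ) • embedding hn v) * expQuot ((n : ℝ) • embedding hn v)) - 1)

theorem rightSide_ae_eq {n : ℕ} (hn : 2 ≤ n) (v : axialSobolev n) :
    ∀ᵐ x ∂(axialMeasure n), rightSide hn v x = -(1 - sphereConst n *
      (Real.exp (n * toFn v x) / ∫ y, Real.exp (n * toFn v y) ∂(axialMeasure n))) := by
  rw [integral_exp_toFn hn]
  filter_upwards [BoundedContinuousFunction.coeFn_toLp 2 (axialMeasure n) ℝ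
    ((sphereConst n / expIntegral n ((n : ℝ) • embedding hn v)) •
      (1 + ((n : ℝ) • embedding hn v) * expQuot ((n : ℝ) • embedding hn v)) - 1),
    embedding_ae_eq hn v] with x h1 h2
  rw [rightSide, h1, h2]
  have h3 := mul_expQuot_apply ((n : ℝ) • embedding hn v) x
  simp only [BoundedContinuousFunction.coe_smul, smul_eq_mul, BoundedContinuousFunction.coe_sub,
    BoundedContinuousFunction.coe_add, BoundedContinuousFunction.coe_mul, Pi.sub_apply,
    Pi.add_apply, Pi.mul_apply, BoundedContinuousFunction.coe_one, Pi.one_apply] at h3 ⊢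
  rw [h3]
  ring

theorem isSolution_iff_isPaneitz {n : ℕ} (hn : 2 ≤ n) (ρ : ℝ) (v : axialSobolev n) :
    IsSolution n ρ v ↔ IsPaneitz n (toFn v) (ρ • rightSide hn v) := by
  constructor
  · rintro ⟨f, hf, hae⟩
    have : f = ρ • rightSide hn v := by
      refine Lp.ext ?_
      filter_upwards [hae, rightSide_ae_eq hn v, Lp.coeFn_smul ρ (rightSide hn v)] with x h1 h2 h3
      rw [h3, Pi.smul_apply, h2, smul_eq_mul]
      linarith
    rwa [← this]
  · intro h
    refine ⟨_, h, ?_⟩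
    filter_upwards [rightSide_ae_eq hn v, Lp.coeFn_smul ρ (rightSide hn v)] with x h2 h3
    rw [h3, Pi.smul_apply, h2, smul_eq_mul]
    ring

theorem repr_rightSide_zero {n : ℕ} (hn : 2 ≤ n) (v : axialSobolev n) :
    (gegenbauerBasis hn).repr (rightSide hn v) 0 = 0 := by
  have h := (expIntegral_pos hn ((n : ℝ) • embedding hn v)).ne'
  rw [rightSide, repr_toLp_zero, map_sub, map_smul, bcfIntegral_one hn, ← expIntegral,
    smul_eq_mul, div_mul_cancel₀ _ h, sub_self, mul_zero]

theorem green_rightSide {n : ℕ} (hn : 2 ≤ n) (v : axialSobolev n) :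
    green hn (rightSide hn v) = blowup hn (1, v) := by
  refine axialSobolev_ext hn fun k => ?_
  have hb : toFn (blowup hn (1, v)) = (expIntegral n (((n : ℝ) * 1) • embedding hn v))⁻¹ •
      toFn (green hn (BoundedContinuousFunction.toLp 2 (axialMeasure n) ℝ
        (((n : ℝ) * sphereConst n) •
          (embedding hn v * expQuot (((n : ℝ) * 1) • embedding hn v))))) := rfl
  rw [hb, map_smul, lp.coeFn_smul, Pi.smul_apply, repr_green, repr_green, smul_eq_mul, mul_one]
  rcases eq_or_ne k 0 with rfl | hk
  · rw [eigenvalue_zero hn]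
    simp
  · rw [rightSide, map_sub, map_sub, map_smul, map_add, map_smul, map_add, lp.coeFn_sub,
      Pi.sub_apply, lp.coeFn_smul, Pi.smul_apply, lp.coeFn_add, Pi.add_apply,
      repr_toLp_one hn hk, smul_mul_assoc, map_smul, map_smul, map_smul, map_smul, lp.coeFn_smul,
      Pi.smul_apply, lp.coeFn_smul, Pi.smul_apply]
    simp only [smul_eq_mul]
    ring

theorem isSolution_iff {n : ℕ} (hn : 2 ≤ n) (ρ : ℝ) (v : axialSobolev n) :
    IsSolution n ρ v ↔ v = ρ • blowup hn (1, v) := by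
  rw [isSolution_iff_isPaneitz hn, isPaneitz_iff hn, ← green_rightSide, ← map_smul]
  constructor
  · intro h
    refine axialSobolev_ext hn fun k => ?_
    rw [repr_green, h k]
    rcases Nat.eq_zero_or_pos k with rfl | hk
    · rw [repr_toFn_zero]
      simp
    · rw [inv_mul_cancel_left₀ (eigenvalue_pos n hk).ne']
  · intro h k
    have h2 := congrArg (fun v => (gegenbauerBasis hn).repr (toFn v) k) h
    simp only [repr_green] at h2
    rw [h2]
    rcases Nat.eq_zero_or_pos k with rfl | hk
    · rw [map_smul, lp.coeFn_smul, Pi.smul_apply, repr_rightSide_zero, eigenvalue_zero hn]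
      simp
    · rw [mul_inv_cancel_left₀ (eigenvalue_pos n hk).ne']

theorem isSolution_zero {n : ℕ} (hn : 2 ≤ n) (ρ : ℝ) : IsSolution n ρ 0 := by
  rw [isSolution_iff hn]
  have h := blowup_smul hn 0 0
  rw [zero_smul, zero_smul] at h
  rw [h, smul_zero]

theorem bcfIntegral_embedding {n : ℕ} (hn : 2 ≤ n) (v : axialSobolev n) :
    bcfIntegral n (embedding hn v) = 0 := by
  have h := repr_toLp_zero hn (embedding hn v)
  rw [toLp_embedding, repr_toFn_zero] at h
  have h1 := (Real.sqrt_pos.2 (gegenbauerNormSq_pos hn 0)).ne'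
  exact (mul_eq_zero.1 h.symm).resolve_left (inv_ne_zero h1)

/-- The mean of `e^{nεz}` does not contribute to first order, as `z` has mean zero. -/
theorem hasDerivAt_blowup {n : ℕ} (hn : 2 ≤ n) (z : axialSobolev n) :
    HasDerivAt (fun ε : ℝ => blowup hn (ε, z))
      (((n : ℝ) ^ 2 / 2) • green hn (BoundedContinuousFunction.toLp 2 (axialMeasure n) ℝ
        (embedding hn z * embedding hn z))) 0 := by
  set β := embedding hn z with hβ
  have hc := (sphereConst_pos hn).ne'
  have h1 : HasDerivAt (fun ε : ℝ => ((n : ℝ) * ε) • β) ((n : ℝ) • β) 0 := by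
    simpa using ((hasDerivAt_id (0 : ℝ)).const_mul (n : ℝ)).smul_const β
  have h2 : HasDerivAt (fun ε : ℝ => expQuot (((n : ℝ) * ε) • β)) (((n : ℝ) / 2) • β) 0 := by
    have h3 : HasFDerivAt (expQuot : BoundedContinuousFunction ℝ ℝ → _)
        ((2⁻¹ : ℝ) • ContinuousLinearMap.id ℝ (BoundedContinuousFunction ℝ ℝ))
        (((n : ℝ) * 0) • β) := by
      rw [mul_zero, zero_smul]
      exact hasFDerivAt_expQuot_zero
    refine (h3.comp_hasDerivAt (0 : ℝ) h1).congr_deriv ?_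
    simp only [smul_apply, ContinuousLinearMap.id_apply, smul_smul]
    congr 1
    ring
  have h4 : HasDerivAt (fun ε : ℝ => expIntegral n (((n : ℝ) * ε) • β)) 0 0 := by
    have h5 := (bcfIntegral n).hasFDerivAt.comp_hasDerivAt (0 : ℝ) ((h1.mul h2).const_add 1)
    refine h5.congr_deriv ?_
    simp [expQuot_zero, hβ, bcfIntegral_embedding hn]
  have h6 := (green hn).hasFDerivAt.comp_hasDerivAt (0 : ℝ)
    ((BoundedContinuousFunction.toLp 2 (axialMeasure n) ℝ).hasFDerivAt.comp_hasDerivAt (0 : ℝ)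
      ((h2.const_mul β).const_smul ((n : ℝ) * sphereConst n)))
  have h7 := (h4.inv (expIntegral_pos hn _).ne').smul h6
  refine h7.congr_deriv ?_
  simp only [mul_zero, zero_smul, neg_zero, zero_div, add_zero, expIntegral_zero hn, Pi.inv_apply]
  rw [mul_smul_comm, map_smul, map_smul, map_smul, map_smul, smul_smul, smul_smul]
  congr 1
  field_simp

/-! ### The local branches -/

/-- Coefficients at the bifurcation value `ρ_k` of `1 - ρ_k A`, with the kernel direction replaced
by multiplication by `-1 / ρ_k`. -/
noncomputable def bifurcationSymbol (n k j : ℕ) : ℝ :=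
  if j = k then -(bifValue n k)⁻¹ else 1 - eigenvalue n k * (eigenvalue n j)⁻¹

theorem bifValue_pos {n : ℕ} (hn : 2 ≤ n) {k : ℕ} (hk : 1 ≤ k) : 0 < bifValue n k :=
  div_pos (eigenvalue_pos n hk) (by positivity)

theorem abs_bifurcationSymbol_le {n : ℕ} (hn : 2 ≤ n) {k : ℕ} (hk : 1 ≤ k) (j : ℕ) :
    |bifurcationSymbol n k j| ≤ (bifValue n k)⁻¹ + 1 + eigenvalue n k := by
  have h1 := bifValue_pos hn hk
  have h2 := eigenvalue_pos n hk
  rw [bifurcationSymbol]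
  split_ifs with h
  · rw [abs_neg, abs_of_pos (by positivity)]
    linarith
  · have h3 : |eigenvalue n k * (eigenvalue n j)⁻¹| ≤ eigenvalue n k := by
      rw [abs_mul, abs_of_pos h2]
      exact mul_le_of_le_one_right h2.le (abs_inv_eigenvalue_le hn j)
    have h4 : 0 < (bifValue n k)⁻¹ := by positivity
    calc |1 - eigenvalue n k * (eigenvalue n j)⁻¹|
        ≤ |1| + |eigenvalue n k * (eigenvalue n j)⁻¹| := abs_sub _ _
      _ ≤ _ := by rw [abs_one]; linarith

/-- The eigenvalues other than `λ_k` stay away from `λ_k`. -/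
theorem exists_eigenvalue_gap {n : ℕ} (hn : 2 ≤ n) {k : ℕ} (hk : 1 ≤ k) :
    ∃ g > 0, ∀ j, j ≠ k → g ≤ |eigenvalue n j - eigenvalue n k| := by
  have hmono := eigenvalue_strictMono hn
  refine ⟨min (eigenvalue n (k + 1) - eigenvalue n k) (eigenvalue n k - eigenvalue n (k - 1)),
    lt_min (sub_pos.2 (hmono (by omega))) (sub_pos.2 (hmono (by omega))), fun j hj => ?_⟩
  rcases lt_or_gt_of_ne hj with h | h
  · have : eigenvalue n j ≤ eigenvalue n (k - 1) := hmono.monotone (by omega)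
    refine (min_le_right _ _).trans ?_
    rw [abs_sub_comm]
    exact le_trans (by linarith) (le_abs_self _)
  · have : eigenvalue n (k + 1) ≤ eigenvalue n j := hmono.monotone (by omega)
    refine (min_le_left _ _).trans ?_
    exact le_trans (by linarith) (le_abs_self _)

theorem bifurcationSymbol_ne_zero {n : ℕ} (hn : 2 ≤ n) {k : ℕ} (hk : 1 ≤ k) (j : ℕ) :
    bifurcationSymbol n k j ≠ 0 := by
  rw [bifurcationSymbol]
  split_ifs with h
  · exact neg_ne_zero.2 (inv_ne_zero (bifValue_pos hn hk).ne')
  · rcases Nat.eq_zero_or_pos j with rfl | hj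
    · simp [eigenvalue_zero hn]
    · rw [sub_ne_zero, ne_comm, ← div_eq_mul_inv, Ne, div_eq_one_iff_eq (eigenvalue_pos n hj).ne']
      exact (eigenvalue_strictMono hn).injective.ne (Ne.symm h)

theorem exists_abs_inv_bifurcationSymbol_le {n : ℕ} (hn : 2 ≤ n) {k : ℕ} (hk : 1 ≤ k) :
    ∃ M, ∀ j, |(bifurcationSymbol n k j)⁻¹| ≤ M := by
  obtain ⟨g, hg, hgap⟩ := exists_eigenvalue_gap hn hk
  have h1 := bifValue_pos hn hk
  have h2 := eigenvalue_pos n hk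
  refine ⟨bifValue n k + (1 + eigenvalue n k / g), fun j => ?_⟩
  have h3 : 0 ≤ eigenvalue n k / g := by positivity
  rw [bifurcationSymbol]
  split_ifs with h
  · rw [abs_inv, abs_neg, abs_inv, inv_inv, abs_of_pos h1]
    linarith
  · rcases Nat.eq_zero_or_pos j with rfl | hj
    · simp [eigenvalue_zero hn]
      linarith
    · have hj0 := (eigenvalue_pos n hj).ne'
      have hne : eigenvalue n j - eigenvalue n k ≠ 0 :=
        sub_ne_zero.2 ((eigenvalue_strictMono hn).injective.ne h)
      have heq : (1 - eigenvalue n k * (eigenvalue n j)⁻¹)⁻¹ =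
          1 + eigenvalue n k / (eigenvalue n j - eigenvalue n k) := by
        have : 1 - eigenvalue n k * (eigenvalue n j)⁻¹ =
            (eigenvalue n j - eigenvalue n k) / eigenvalue n j := by field_simp
        rw [this, inv_div]
        field_simp
        ring
      rw [heq]
      calc |1 + eigenvalue n k / (eigenvalue n j - eigenvalue n k)|
          ≤ |1| + |eigenvalue n k / (eigenvalue n j - eigenvalue n k)| := abs_add_le _ _
        _ ≤ 1 + eigenvalue n k / g := by
          rw [abs_one, abs_div, abs_of_pos h2]
          gcongr
          exact hgap j h
        _ ≤ _ := by linarith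

/-- The coefficient of `C_k`, as a functional on `𝒱`. -/
noncomputable def kernelCoord {n : ℕ} (hn : 2 ≤ n) (k : ℕ) : axialSobolev n →L[ℝ] ℝ :=
  (Real.sqrt (gegenbauerNormSq n k))⁻¹ • innerSL ℝ (gegenbauerBasis hn k) ∘L toFnL n

theorem kernelCoord_apply {n : ℕ} (hn : 2 ≤ n) (k : ℕ) (v : axialSobolev n) :
    kernelCoord hn k v = (Real.sqrt (gegenbauerNormSq n k))⁻¹ *
      (gegenbauerBasis hn).repr (toFn v) k := by
  rw [HilbertBasis.repr_apply_apply]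
  rfl

theorem kernelCoord_eq_integral {n : ℕ} (hn : 2 ≤ n) (k : ℕ) (v : axialSobolev n) :
    kernelCoord hn k v = (gegenbauerNormSq n k)⁻¹ *
      ∫ x, toFn v x * (sphereGegenbauer n k).eval x ∂(axialMeasure n) := by
  rw [kernelCoord_apply, repr_gegenbauerBasis, ← mul_assoc, ← mul_inv,
    Real.mul_self_sqrt (gegenbauerNormSq_pos hn k).le]

/-- The linear map to be inverted in the implicit function theorem is diagonal in the Gegenbauer
basis, with entries `bifurcationSymbol n k`. -/
theorem exists_bifurcationEquiv {n : ℕ} (hn : 2 ≤ n) {k : ℕ} (hk : 1 ≤ k) {w : axialSobolev n}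
    (hw : toFn w = polyL2 n (sphereGegenbauer n k)) :
    ∃ B : axialSobolev n ≃L[ℝ] axialSobolev n, ∀ z, B z = z - bifValue n k • linearization hn z -
      ((bifValue n k)⁻¹ * kernelCoord hn k z) • w := by
  obtain ⟨S, hS⟩ := exists_diagonal_axialSobolev hn _ _ (abs_bifurcationSymbol_le hn hk)
  obtain ⟨M, hM⟩ := exists_abs_inv_bifurcationSymbol_le hn hk
  obtain ⟨S', hS'⟩ := exists_diagonal_axialSobolev hn _ _ hM
  refine ⟨ContinuousLinearEquiv.equivOfInverse S S' (fun v => ?_) (fun v => ?_), fun z => ?_⟩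
  · refine axialSobolev_ext hn fun j => ?_
    rw [hS', hS, inv_mul_cancel_left₀ (bifurcationSymbol_ne_zero hn hk j)]
  · refine axialSobolev_ext hn fun j => ?_
    rw [hS, hS', mul_inv_cancel_left₀ (bifurcationSymbol_ne_zero hn hk j)]
  · refine axialSobolev_ext hn fun j => ?_
    rw [ContinuousLinearEquiv.equivOfInverse_apply, hS]
    have h : toFn (z - bifValue n k • linearization hn z -
        ((bifValue n k)⁻¹ * kernelCoord hn k z) • w) = toFn z -
          bifValue n k • toFn (linearization hn z) -
            ((bifValue n k)⁻¹ * kernelCoord hn k z) • toFn w := rfl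
    rw [h, map_sub, map_sub, map_smul, map_smul, lp.coeFn_sub, Pi.sub_apply, lp.coeFn_sub,
      Pi.sub_apply, lp.coeFn_smul, Pi.smul_apply, lp.coeFn_smul, Pi.smul_apply,
      repr_linearization, hw, repr_polyL2_sphereGegenbauer, kernelCoord_apply, bifurcationSymbol]
    simp only [smul_eq_mul]
    have hn0 : (n : ℝ) ≠ 0 := by positivity
    have hl := (eigenvalue_pos n hk).ne'
    have hs := (Real.sqrt_pos.2 (gegenbauerNormSq_pos hn k)).ne'
    split_ifs with hjk
    · subst hjk
      rw [bifValue]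
      field_simp
      ring
    · rw [bifValue, mul_zero]
      field_simp
      ring

/-- The local branch at `ρ_k`, with the first derivative of its `ρ`-component. -/
theorem exists_localBranch {n : ℕ} (hn : 2 ≤ n) {k : ℕ} (hk : 1 ≤ k) {w : axialSobolev n}
    (hw : toFn w = polyL2 n (sphereGegenbauer n k)) :
    ∃ (ε₀ : ℝ) (r : ℝ → ℝ) (ψ : ℝ → axialSobolev n), IsLocalBranch n k w ε₀ r ψ ∧
      HasDerivAt r (-(eigenvalue n k / 2) *
        (polyIntegral n (sphereGegenbauer n k ^ 3) / gegenbauerNormSq n k)) 0 := by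
  have := completeSpace_axialSobolev hn
  obtain ⟨B, hB⟩ := exists_bifurcationEquiv hn hk hw
  have hn0 : (n : ℝ) ≠ 0 := by positivity
  have hl := (eigenvalue_pos n hk).ne'
  have hnorm := gegenbauerNormSq_pos hn k
  have hs := (Real.sqrt_pos.2 hnorm).ne'
  have hlw : kernelCoord hn k w = 1 := by
    rw [kernelCoord_apply, hw, repr_polyL2_sphereGegenbauer, if_pos rfl, inv_mul_cancel₀ hs]
  have hAw : linearization hn w = (bifValue n k)⁻¹ • w := by
    refine axialSobolev_ext hn fun j => ?_
    have h : toFn ((bifValue n k)⁻¹ • w) = (bifValue n k)⁻¹ • toFn w := rfl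
    rw [h, map_smul, lp.coeFn_smul, Pi.smul_apply, repr_linearization, hw,
      repr_polyL2_sphereGegenbauer, smul_eq_mul, bifValue]
    split_ifs with hjk
    · subst hjk
      field_simp
    · simp
  have hlA : ∀ z, kernelCoord hn k (linearization hn z) =
      (bifValue n k)⁻¹ * kernelCoord hn k z := by
    intro z
    rw [kernelCoord_apply, kernelCoord_apply, repr_linearization, bifValue]
    field_simp
  obtain ⟨ε₀, r, ψ, hpos, hr, hψ, hr0, hψ0, horth, ⟨U, hU, hUm, hUeq⟩, hderiv⟩ :=
    crandall_rabinowitz (contDiff_blowup hn) (blowup_zero hn) (blowup_smul hn)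
      (bifValue_pos hn hk).ne' hlw hAw hlA B hB (hasDerivAt_blowup hn w)
  refine ⟨ε₀, r, ψ, ⟨hpos, hr, hψ, hr0, hψ0, fun ε hε => ?_, U, hU, hUm, ?_⟩, ?_⟩
  · have h := horth ε hε
    rw [kernelCoord_eq_integral] at h
    exact (mul_eq_zero.1 h).resolve_left (inv_ne_zero hnorm.ne')
  · rw [← hUeq]
    congr 1
    ext p
    simp only [nontrivialSolutions, mem_ofPred_eq, isSolution_iff hn]
  · refine hderiv.congr_deriv ?_
    rw [map_smul, kernelCoord_apply, repr_green, repr_gegenbauerBasis]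
    have hint : ∫ x, BoundedContinuousFunction.toLp 2 (axialMeasure n) ℝ
        (embedding hn w * embedding hn w) x * (sphereGegenbauer n k).eval x ∂(axialMeasure n) =
          polyIntegral n (sphereGegenbauer n k ^ 3) := by
      rw [polyIntegral_apply]
      refine integral_congr_ae ?_
      filter_upwards [BoundedContinuousFunction.coeFn_toLp 2 (axialMeasure n) ℝ
        (embedding hn w * embedding hn w), embedding_ae_eq hn w,
        coeFn_polyL2 n (sphereGegenbauer n k)] with x h1 h2 h3
      rw [h1, BoundedContinuousFunction.coe_mul, Pi.mul_apply, ← h2, hw, h3, eval_pow]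
      ring
    have hsq := Real.mul_self_sqrt hnorm.le
    rw [hint, smul_eq_mul, bifValue]
    nth_rewrite 3 [← hsq]
    field_simp

open Filter in
theorem isBifurcationPoint {n : ℕ} (hn : 2 ≤ n) {k : ℕ} {w : axialSobolev n} {ε₀ : ℝ} {r : ℝ → ℝ}
    {ψ : ℝ → axialSobolev n} (h : IsLocalBranch n k w ε₀ r ψ) :
    IsBifurcationPoint n (bifValue n k) := by
  refine ⟨Eventually.of_forall fun ρ => isSolution_zero hn ρ, ?_⟩
  obtain ⟨U, -, -, hUeq⟩ := h.solutions
  have h0 : (0 : ℝ) ∈ Ioo (-ε₀) ε₀ := ⟨neg_lt_zero.2 h.pos, h.pos⟩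
  have hmem := Ioo_mem_nhds h0.1 h0.2
  have hr : ContinuousAt r 0 := (h.contDiff_r.continuousOn).continuousAt hmem
  have hψ : ContinuousAt ψ 0 := (h.contDiff_ψ.continuousOn).continuousAt hmem
  have hc : ContinuousAt (fun ε : ℝ => ((r ε, ε • w + ε • ψ ε) : ℝ × axialSobolev n)) 0 := by
    fun_prop
  have ht : Tendsto (fun ε : ℝ => ((r ε, ε • w + ε • ψ ε) : ℝ × axialSobolev n)) (𝓝[≠] 0)
      (𝓝 (bifValue n k, 0)) := by
    have := hc.tendsto
    simp only [h.r_zero, zero_smul, add_zero] at this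
    exact this.mono_left nhdsWithin_le_nhds
  refine mem_closure_of_tendsto ht ?_
  filter_upwards [nhdsWithin_le_nhds hmem, self_mem_nhdsWithin] with ε hε hne
  have : ((r ε, ε • w + ε • ψ ε) : ℝ × axialSobolev n) ∈ nontrivialSolutions n ∩ U := by
    rw [hUeq]
    exact ⟨ε, hε, hne, rfl⟩
  exact this.1

theorem isTranscritical_of_hasDerivAt {r : ℝ → ℝ} {r' : ℝ} (h : HasDerivAt r r' 0) (hr' : r' ≠ 0) :
    IsTranscritical r := by
  have h1 : ∀ᶠ ε in 𝓝 (0 : ℝ), |r ε - r 0 - r' * ε| ≤ |r'| / 2 * |ε| := by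
    have := (hasDerivAt_iff_isLittleO.1 h).def (half_pos (abs_pos.2 hr'))
    simpa [mul_comm] using this
  obtain ⟨δ, hδ, hball⟩ := Metric.eventually_nhds_iff.1 h1
  refine ⟨δ, hδ, fun ε hε => ?_⟩
  have hp := hball (y := ε) (by rw [Real.dist_eq, sub_zero, abs_of_pos hε.1]; exact hε.2)
  have hm := hball (y := -ε) (by rw [Real.dist_eq, sub_zero, abs_neg, abs_of_pos hε.1]; exact hε.2)
  rw [abs_neg] at hm
  rw [abs_of_pos hε.1, abs_le] at hp hm
  have hε0 := hε.1
  rcases lt_or_gt_of_ne hr' with hlt | hgt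
  · rw [abs_of_neg hlt] at hp hm
    have : r' * ε < 0 := mul_neg_of_neg_of_pos hlt hε0
    exact mul_neg_of_neg_of_pos (by linarith) (by linarith)
  · rw [abs_of_pos hgt] at hp hm
    have : 0 < r' * ε := mul_pos hgt hε0
    exact mul_neg_of_pos_of_neg (by linarith) (by linarith)

/-! ### The second Gegenbauer polynomial -/

theorem sphereGegenbauer_two (n : ℕ) : sphereGegenbauer n 2 =
    C (((n : ℝ) - 1) / 2) * (C ((n : ℝ) + 1) * X ^ 2 - 1) := by
  have h : ∀ ν : ℝ, gegenbauer ν 2 = C ν * (C (2 * ν + 2) * X ^ 2 - 1) := by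
    intro ν
    have hne : (C (2 : ℝ) : ℝ[X]) ≠ 0 := C_ne_zero.2 two_ne_zero
    refine mul_left_cancel₀ hne ?_
    have h1 := gegenbauer_rec ν 0
    simp only [Nat.cast_zero, zero_add, gegenbauer] at h1 ⊢
    rw [h1]
    simp only [map_add, map_mul, map_one, map_ofNat]
    ring
  rw [sphereGegenbauer, h]
  congr 4
  ring

theorem gegenbauer_two_integrals {n : ℕ} (hn : 2 ≤ n) :
    polyIntegral n (sphereGegenbauer n 2 ^ 3) / gegenbauerNormSq n 2 =
      2 * ((n : ℝ) - 1) ^ 2 / (n + 5) := by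
  have hn' : (2 : ℝ) ≤ n := by exact_mod_cast hn
  have hc := (sphereConst_pos hn).ne'
  have m2 := polyIntegral_moment hn 0
  have m4 := polyIntegral_moment hn 2
  have m6 := polyIntegral_moment hn 4
  rw [pow_zero, polyIntegral_one hn] at m2
  norm_num at m2 m4 m6
  have e1 : ((n : ℝ) + 1) ≠ 0 := by positivity
  have e3 : ((n : ℝ) + 3) ≠ 0 := by positivity
  have e5 : ((n : ℝ) + 5) ≠ 0 := by positivity
  have e0 : ((n : ℝ) - 1) ≠ 0 := by linarith
  have m2' : polyIntegral n (X ^ 2) = sphereConst n / (n + 1) := by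
    rw [eq_div_iff e1]; linarith
  have m4' : polyIntegral n (X ^ 4) = 3 * sphereConst n / ((n + 1) * (n + 3)) := by
    rw [eq_div_iff (mul_ne_zero e1 e3)]
    linear_combination ((n : ℝ) + 1) * m4 + 3 * m2
  have m6' : polyIntegral n (X ^ 6) = 15 * sphereConst n / ((n + 1) * (n + 3) * (n + 5)) := by
    rw [eq_div_iff (mul_ne_zero (mul_ne_zero e1 e3) e5)]
    linear_combination ((n : ℝ) + 1) * (n + 3) * m6 + 5 * ((n : ℝ) + 1) * m4 + 15 * m2
  have h2 : gegenbauerNormSq n 2 = (((n : ℝ) - 1) / 2) ^ 2 * (((n : ℝ) + 1) ^ 2 *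
      polyIntegral n (X ^ 4) - 2 * (n + 1) * polyIntegral n (X ^ 2) + sphereConst n) := by
    rw [gegenbauerNormSq, sphereGegenbauer_two, ← polyIntegral_one hn,
      show (C (((n : ℝ) - 1) / 2) * (C ((n : ℝ) + 1) * X ^ 2 - 1)) ^ 2 =
        C ((((n : ℝ) - 1) / 2) ^ 2) * (C (((n : ℝ) + 1) ^ 2) * X ^ 4 -
          C (2 * ((n : ℝ) + 1)) * X ^ 2 + 1) by
        simp only [map_add, map_mul, map_one, map_ofNat, map_pow]; ring,
      polyIntegral_C_mul, map_add, map_sub, polyIntegral_C_mul, polyIntegral_C_mul]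
  have h3 : polyIntegral n (sphereGegenbauer n 2 ^ 3) = (((n : ℝ) - 1) / 2) ^ 3 *
      (((n : ℝ) + 1) ^ 3 * polyIntegral n (X ^ 6) - 3 * (n + 1) ^ 2 * polyIntegral n (X ^ 4) +
        3 * (n + 1) * polyIntegral n (X ^ 2) - sphereConst n) := by
    rw [sphereGegenbauer_two, ← polyIntegral_one hn,
      show (C (((n : ℝ) - 1) / 2) * (C ((n : ℝ) + 1) * X ^ 2 - 1)) ^ 3 =
        C ((((n : ℝ) - 1) / 2) ^ 3) * (C (((n : ℝ) + 1) ^ 3) * X ^ 6 -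
          C (3 * ((n : ℝ) + 1) ^ 2) * X ^ 4 + C (3 * ((n : ℝ) + 1)) * X ^ 2 - 1) by
        simp only [map_add, map_mul, map_one, map_ofNat, map_pow]; ring,
      polyIntegral_C_mul, map_sub, map_add, map_sub, polyIntegral_C_mul, polyIntegral_C_mul,
      polyIntegral_C_mul]
  have h2' : gegenbauerNormSq n 2 =
      (((n : ℝ) - 1) / 2) ^ 2 * (2 * n * sphereConst n / (n + 3)) := by
    rw [h2, m2', m4']
    field_simp
    ring
  have h3' : polyIntegral n (sphereGegenbauer n 2 ^ 3) = (((n : ℝ) - 1) / 2) ^ 3 *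
      (8 * n * (n - 1) * sphereConst n / ((n + 3) * (n + 5))) := by
    rw [h3, m2', m4', m6']
    field_simp
    ring
  have hn0 : (n : ℝ) ≠ 0 := by positivity
  rw [h2', h3']
  field_simp
  ring

theorem eigenvalue_two (n : ℕ) : eigenvalue n 2 = ((n + 1).factorial : ℝ) := by
  induction n with
  | zero => simp [eigenvalue]
  | succ n ih =>
    rw [eigenvalue, Finset.prod_range_succ, ← eigenvalue, ih, Nat.factorial_succ (n + 1)]
    push_cast
    ring

/-! ### The Paneitz operator in even dimensions, on polynomials -/

/-- The `r`-th derivative of an equation of Gegenbauer type is again of this type. -/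
theorem iterate_derivative_ode {p : ℝ[X]} {α c : ℝ}
    (h : (1 - X ^ 2) * derivative (derivative p) + C α * X * derivative p + C c * p = 0) (r : ℕ) :
    (1 - X ^ 2) * derivative^[r + 2] p + C (α - 2 * r) * X * derivative^[r + 1] p +
      C (c + r * α - r * (r - 1)) * derivative^[r] p = 0 := by
  induction r with
  | zero => simpa using h
  | succ r ih =>
    have hd := congrArg derivative ih
    simp only [derivative_add, derivative_mul, derivative_sub, derivative_one, derivative_X_pow,
      derivative_C, derivative_X, derivative_zero, ← Function.iterate_succ_apply'] at hd
    push_cast at hd ⊢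
    simp only [map_add, map_sub, map_mul, map_one, map_ofNat] at hd ⊢
    linear_combination hd

/-- An eigenpolynomial with eigenvalue `laplaceEigenvalue n k` is determined by its `k`-th
coefficient. -/
theorem eq_zero_of_negLaplacian {n : ℕ} (hn : 2 ≤ n) {z : ℝ[X]} {k : ℕ}
    (hz : negLaplacian n z = laplaceEigenvalue n k • z)
    (hk : z.coeff k = 0) : z = 0 := by
  by_contra hne
  -- After `natDegree z` derivatives only the eigenvalue equation for a nonzero constant is left.
  have hode : (1 - X ^ 2) * derivative (derivative z) + C (-(n : ℝ)) * X * derivative z +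
      C (laplaceEigenvalue n k) * z = 0 := by
    rw [negLaplacian, smul_eq_C_mul] at hz
    rw [C_neg, C_eq_natCast]
    linear_combination -hz
  have h := iterate_derivative_ode hode z.natDegree
  rw [iterate_derivative_eq_zero (by omega : z.natDegree < z.natDegree + 2),
    iterate_derivative_eq_zero (by omega : z.natDegree < z.natDegree + 1), mul_zero, mul_zero,
    zero_add, zero_add, mul_eq_zero] at h
  rcases h with h | h
  · rw [C_eq_zero] at h
    have hmu : laplaceEigenvalue n z.natDegree = laplaceEigenvalue n k := by
      rw [laplaceEigenvalue]
      linarith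
    have hd := (laplaceEigenvalue_strictMono hn).injective hmu
    rw [← hd, coeff_natDegree, leadingCoeff_eq_zero] at hk
    exact hne hk
  · have h0 := congrArg (coeff · 0) h
    simp only [coeff_iterate_derivative, zero_add, coeff_zero, smul_eq_zero,
      Nat.descFactorial_self, coeff_natDegree, leadingCoeff_eq_zero] at h0
    rcases h0 with h0 | h0
    · exact Nat.factorial_ne_zero _ h0
    · exact hne h0

theorem derivative_one_sub_sq_pow (m : ℕ) :
    (1 - X ^ 2 : ℝ[X]) * derivative ((1 - X ^ 2) ^ m) = -(C (2 * (m : ℝ)) * X * (1 - X ^ 2) ^ m) := by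
  rcases m with _ | m
  · simp
  · rw [derivative_pow_succ]
    simp only [derivative_sub, derivative_one, derivative_X_pow, map_mul, map_ofNat]
    have h2 : (C (2 : ℝ) : ℝ[X]) = 2 := map_ofNat C 2
    push_cast
    simp only [h2, map_add, map_natCast, map_one]
    ring

theorem natDegree_one_sub_sq_pow_le (b : ℕ) : ((1 - X ^ 2 : ℝ[X]) ^ b).natDegree ≤ 2 * b := by
  refine natDegree_pow_le.trans ?_
  have : (1 - X ^ 2 : ℝ[X]).natDegree ≤ 2 := by compute_degree
  rw [mul_comm]
  gcongr

theorem coeff_one_sub_sq_pow (b : ℕ) : ((1 - X ^ 2 : ℝ[X]) ^ b).coeff (2 * b) = (-1) ^ b := by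
  induction b with
  | zero => simp
  | succ b ih =>
    rw [pow_succ, mul_add, coeff_mul_add_eq_of_natDegree_le (natDegree_one_sub_sq_pow_le b)
      (by compute_degree), ih]
    simp [coeff_one, pow_succ]

theorem derivative_pow_mul_derivative_sphereGegenbauer (b k : ℕ) :
    derivative ((1 - X ^ 2) ^ (b + 1) * derivative (sphereGegenbauer (2 * b + 2) k)) =
      -(C (laplaceEigenvalue (2 * b + 2) k) *
        ((1 - X ^ 2) ^ b * sphereGegenbauer (2 * b + 2) k)) := by
  have hy' := negLaplacian_sphereGegenbauer (2 * b + 2) k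
  have hne : (1 - X ^ 2 : ℝ[X]) ≠ 0 := fun h => by
    have := congrArg (eval 0) h
    simp at this
  refine mul_left_cancel₀ hne ?_
  have hq1 := derivative_one_sub_sq_pow (b + 1)
  rw [negLaplacian, smul_eq_C_mul] at hy'
  rw [derivative_mul]
  push_cast at hq1 hy'
  simp only [map_mul, map_add, map_one, map_ofNat, C_eq_natCast] at hq1
  linear_combination derivative (sphereGegenbauer (2 * b + 2) k) * hq1 -
    (1 - X ^ 2) ^ (b + 1) * hy'

/-- `g = (1 - x²)^b C_k` solves a second order equation whose `2b`-th derivative is the equation of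
`C_k` again. So `g⁽²ᵇ⁾` is the multiple of `C_k` that has the same top coefficient. -/
theorem iterate_derivative_gegenbauer (b k : ℕ) :
    derivative^[2 * b] ((1 - X ^ 2) ^ b * sphereGegenbauer (2 * b + 2) k) =
      C ((-1) ^ b * ((k + 2 * b).descFactorial (2 * b) : ℝ)) * sphereGegenbauer (2 * b + 2) k := by
  set n := 2 * b + 2 with hn
  set y := sphereGegenbauer n k with hy
  set μ := laplaceEigenvalue n k with hμ
  set g := (1 - X ^ 2) ^ b * y with hg
  have hdegy : y.natDegree ≤ k := natDegree_gegenbauer_le _ k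
  have hy' : negLaplacian n y = μ • y := negLaplacian_sphereGegenbauer n k
  have hq := derivative_one_sub_sq_pow b
  have hg' : (1 - X ^ 2) * derivative g + C (2 * (b : ℝ)) * X * g =
      (1 - X ^ 2) ^ (b + 1) * derivative y := by
    rw [hg, derivative_mul, pow_succ (1 - X ^ 2) b]
    linear_combination y * hq
  have hdiv : derivative ((1 - X ^ 2) ^ (b + 1) * derivative y) = -(C μ * g) :=
    derivative_pow_mul_derivative_sphereGegenbauer b k
  have hode : (1 - X ^ 2) * derivative (derivative g) + C (2 * (b : ℝ) - 2) * X * derivative g +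
      C (μ + 2 * b) * g = 0 := by
    have hd := congrArg derivative hg'
    rw [hdiv] at hd
    simp only [derivative_add, derivative_mul, derivative_sub, derivative_one, derivative_X_pow,
      derivative_C, derivative_X] at hd
    simp only [map_add, map_sub, map_mul, map_ofNat] at hd ⊢
    push_cast at hd
    simp only [map_ofNat] at hd
    linear_combination hd
  have hY := iterate_derivative_ode hode (2 * b)
  rw [← sub_eq_zero]
  refine eq_zero_of_negLaplacian (n := n) (by omega) (k := k) ?_ ?_
  · rw [Function.iterate_succ_apply', Function.iterate_succ_apply'] at hY
    rw [negLaplacian, smul_eq_C_mul] at hy' ⊢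
    simp only [derivative_sub, derivative_C_mul]
    rw [← hμ]
    have hnC : (n : ℝ[X]) = 2 * C (b : ℝ) + 2 := by rw [hn, C_eq_natCast]; push_cast; ring
    rw [hnC] at hy' ⊢
    push_cast at hY
    simp only [map_add, map_sub, map_mul, map_one, map_ofNat] at hY
    linear_combination -hY - C ((-1) ^ b * ((k + 2 * b).descFactorial (2 * b) : ℝ)) * hy'
  · rw [coeff_sub, coeff_iterate_derivative, coeff_C_mul, add_comm k, hg,
      coeff_mul_add_eq_of_natDegree_le (natDegree_one_sub_sq_pow_le b) hdegy,
      coeff_one_sub_sq_pow, nsmul_eq_mul]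
    ring

theorem eigenvalue_eq_descFactorial (b k : ℕ) : eigenvalue (2 * b + 2) k =
    laplaceEigenvalue (2 * b + 2) k * ((k + 2 * b).descFactorial (2 * b) : ℝ) := by
  have h : ((k + 2 * b).descFactorial (2 * b) : ℝ) =
      ∏ s ∈ Finset.range (2 * b), ((k : ℝ) + ((s + 1 : ℕ) : ℝ)) := by
    rw [Nat.add_descFactorial_eq_ascFactorial, Nat.ascFactorial_eq_prod_range]
    push_cast
    refine Finset.prod_congr rfl fun s _ => by ring
  rw [h, eigenvalue, Finset.prod_range_succ, Finset.prod_range_succ', laplaceEigenvalue]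
  push_cast
  ring

/-- In even dimension `n = 2b + 2`, the differential operator `(-1)^(n/2) [(1 - x²)^(n/2) u']^(n-1)`
acts on the Gegenbauer polynomials as `P_n`. -/
theorem paneitz_sphereGegenbauer (b k : ℕ) :
    derivative^[2 * b + 1]
      ((1 - X ^ 2) ^ (b + 1) * derivative (sphereGegenbauer (2 * b + 2) k)) =
      C ((-1) ^ (b + 1) * eigenvalue (2 * b + 2) k) * sphereGegenbauer (2 * b + 2) k := by
  rw [Function.iterate_succ_apply, derivative_pow_mul_derivative_sphereGegenbauer, Polynomial.iterate_derivative_neg,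
    Polynomial.iterate_derivative_C_mul, iterate_derivative_gegenbauer,
    eigenvalue_eq_descFactorial]
  simp only [map_mul, map_pow, map_neg, map_one]
  ring

/-! ### The distributional equation in even dimensions -/

/-- The operator `P_n` is symmetric. -/
theorem inner_paneitz {n : ℕ} (hn : 2 ≤ n) {u f v g : AxialL2 n} (hu : IsPaneitz n u f)
    (hv : IsPaneitz n v g) : inner ℝ g u = inner ℝ v f := by
  rw [isPaneitz_iff hn] at hu hv
  rw [← (gegenbauerBasis hn).tsum_inner_mul_inner, ← (gegenbauerBasis hn).tsum_inner_mul_inner]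
  refine tsum_congr fun k => ?_
  have h1 := hu k
  have h2 := hv k
  simp only [HilbertBasis.repr_apply_apply] at h1 h2
  rw [real_inner_comm (gegenbauerBasis hn k) g, real_inner_comm (gegenbauerBasis hn k) v, h1, h2]
  ring

/-- Test functions on `(-1, 1)`. -/
structure IsTest (ψ : ℝ → ℝ) : Prop where
  contDiff : ContDiff ℝ ∞ ψ
  hasCompactSupport : HasCompactSupport ψ
  tsupport_subset : tsupport ψ ⊆ Ioo (-1 : ℝ) 1

theorem IsTest.deriv {ψ : ℝ → ℝ} (h : IsTest ψ) : IsTest (deriv ψ) where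
  contDiff := (contDiff_infty_iff_deriv.1 h.contDiff).2
  hasCompactSupport := h.hasCompactSupport.deriv
  tsupport_subset := tsupport_deriv_subset.trans h.tsupport_subset

theorem IsTest.iteratedDeriv {ψ : ℝ → ℝ} (h : IsTest ψ) (m : ℕ) :
    IsTest (iteratedDeriv m ψ) := by
  induction m with
  | zero => rwa [iteratedDeriv_zero]
  | succ m ih => rw [iteratedDeriv_succ]; exact ih.deriv

theorem IsTest.smooth_mul {ψ f : ℝ → ℝ} (h : IsTest ψ) (hf : ContDiff ℝ ∞ f) :
    IsTest fun x => f x * ψ x where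
  contDiff := hf.mul h.contDiff
  hasCompactSupport := h.hasCompactSupport.mul_left
  tsupport_subset := (tsupport_mul_subset_right).trans h.tsupport_subset

theorem IsTest.setIntegral_mul {ψ : ℝ → ℝ} (h : IsTest ψ) (f : ℝ → ℝ) :
    ∫ x in Ioo (-1 : ℝ) 1, ψ x * f x = ∫ x, ψ x * f x := by
  refine setIntegral_eq_integral_of_forall_compl_eq_zero fun x hx => ?_
  rw [image_eq_zero_of_notMem_tsupport fun h' => hx (h.tsupport_subset h'), zero_mul]

theorem IsTest.integrable_mul {ψ f : ℝ → ℝ} (h : IsTest ψ) (hf : Continuous f) :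
    Integrable fun x => ψ x * f x :=
  (h.contDiff.continuous.mul hf).integrable_of_hasCompactSupport h.hasCompactSupport.mul_right

theorem IsTest.integral_deriv_mul {ψ : ℝ → ℝ} (h : IsTest ψ) (p : ℝ[X]) :
    ∫ x in Ioo (-1 : ℝ) 1, _root_.deriv ψ x * p.eval x =
      -∫ x in Ioo (-1 : ℝ) 1, ψ x * (derivative p).eval x := by
  rw [h.deriv.setIntegral_mul, h.setIntegral_mul]
  have := integral_mul_deriv_eq_deriv_mul_of_integrable (u := ψ) (u' := _root_.deriv ψ)
    (v := fun x => p.eval x) (v' := fun x => (derivative p).eval x)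
    (fun x _ => (h.contDiff.differentiable (by simp)).differentiableAt.hasDerivAt)
    (fun x _ => p.hasDerivAt x)
    (h.integrable_mul (derivative p).continuous) (h.deriv.integrable_mul p.continuous)
    (h.integrable_mul p.continuous)
  rw [this, neg_neg]

theorem IsTest.integral_iteratedDeriv_mul {ψ : ℝ → ℝ} (h : IsTest ψ) (m : ℕ) (p : ℝ[X]) :
    ∫ x in Ioo (-1 : ℝ) 1, _root_.iteratedDeriv m ψ x * p.eval x =
      (-1) ^ m * ∫ x in Ioo (-1 : ℝ) 1, ψ x * (derivative^[m] p).eval x := by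
  induction m generalizing p with
  | zero => simp
  | succ m ih =>
    rw [iteratedDeriv_succ, (h.iteratedDeriv m).integral_deriv_mul, ih,
      Function.iterate_succ_apply, pow_succ]
    ring

/-- The operator `u ↦ [(1 - x²)^(n/2) u']^(n-1)` integrated by parts onto the test function, with
`u = C_k`. For even `n = 2b + 2` the signs of the `n` integrations by parts cancel. -/
theorem IsTest.integral_adjoint_mul {ψ : ℝ → ℝ} (h : IsTest ψ) (b k : ℕ) :
    ∫ x in Ioo (-1 : ℝ) 1, _root_.deriv
        (fun y => (1 - y ^ 2) ^ (b + 1) * _root_.iteratedDeriv (2 * b + 1) ψ y) x *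
        (sphereGegenbauer (2 * b + 2) k).eval x =
      (-1) ^ (b + 1) * eigenvalue (2 * b + 2) k *
        ∫ x in Ioo (-1 : ℝ) 1, ψ x * (sphereGegenbauer (2 * b + 2) k).eval x := by
  have h1 := (h.iteratedDeriv (2 * b + 1)).smooth_mul (f := fun y => (1 - y ^ 2) ^ (b + 1))
    (by fun_prop)
  rw [h1.integral_deriv_mul]
  have h2 := h.integral_iteratedDeriv_mul (2 * b + 1)
    ((1 - X ^ 2) ^ (b + 1) * derivative (sphereGegenbauer (2 * b + 2) k))
  rw [paneitz_sphereGegenbauer] at h2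
  simp only [eval_mul, eval_C, eval_pow, eval_sub, eval_one, eval_X] at h2
  have h3 : ∀ x : ℝ, (1 - x ^ 2) ^ (b + 1) * _root_.iteratedDeriv (2 * b + 1) ψ x *
      (derivative (sphereGegenbauer (2 * b + 2) k)).eval x =
      _root_.iteratedDeriv (2 * b + 1) ψ x * ((1 - x ^ 2) ^ (b + 1) *
        (derivative (sphereGegenbauer (2 * b + 2) k)).eval x) := fun x => by ring
  have h4 : ∀ x : ℝ, ψ x * ((-1) ^ (b + 1) * eigenvalue (2 * b + 2) k *
      (sphereGegenbauer (2 * b + 2) k).eval x) = (-1) ^ (b + 1) * eigenvalue (2 * b + 2) k *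
      (ψ x * (sphereGegenbauer (2 * b + 2) k).eval x) := fun x => by ring
  simp only [h3, h2, h4]
  rw [integral_const_mul, pow_succ, pow_mul]
  ring

/-- A test function, divided by the weight of the measure, acts on `L²` as a distribution. -/
theorem IsTest.exists_dual {φ : ℝ → ℝ} (h : IsTest φ) (n : ℕ) : ∃ g : AxialL2 n,
    ∀ u : ℝ → ℝ, ∫ x, u x * g x ∂(axialMeasure n) = ∫ x in Ioo (-1 : ℝ) 1, u x * φ x := by
  set w : ℝ → ℝ := fun x => (1 - x ^ 2) ^ (((n - 2 : ℕ) : ℝ) / 2) with hw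
  have hpos : ∀ x ∈ Ioo (-1 : ℝ) 1, 0 < 1 - x ^ 2 := fun x hx => by nlinarith [hx.1, hx.2]
  have hwpos : ∀ x ∈ Ioo (-1 : ℝ) 1, 0 < w x := fun x hx => Real.rpow_pos_of_pos (hpos x hx) _
  have hsupp : tsupport (fun x => (w x)⁻¹ * φ x) ⊆ tsupport φ := tsupport_mul_subset_right
  have hcont : Continuous fun x => (w x)⁻¹ * φ x := by
    refine ContinuousOn.continuous_of_tsupport_subset (s := Ioo (-1 : ℝ) 1) ?_ isOpen_Ioo
      (hsupp.trans h.tsupport_subset)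
    refine ContinuousOn.mul (ContinuousOn.inv₀ ?_ fun x hx => (hwpos x hx).ne')
      h.contDiff.continuous.continuousOn
    exact ContinuousOn.rpow_const (by fun_prop) fun x hx => Or.inl (hpos x hx).ne'
  have hmem : MemLp (fun x => (w x)⁻¹ * φ x) 2 (axialMeasure n) :=
    hcont.memLp_of_hasCompactSupport (h.hasCompactSupport.mul_left)
  refine ⟨hmem.toLp _, fun u => ?_⟩
  have h1 : ∫ x, u x * hmem.toLp _ x ∂(axialMeasure n) =
      ∫ x, u x * ((w x)⁻¹ * φ x) ∂(axialMeasure n) := by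
    refine integral_congr_ae ?_
    filter_upwards [hmem.coeFn_toLp] with x hx
    rw [hx]
  rw [h1, integral_axialMeasure]
  refine setIntegral_congr_fun measurableSet_Ioo fun x hx => ?_
  have := (hwpos x hx).ne'
  simp only [hw] at this ⊢
  field_simp

/-- Functions in `L²` are determined by their integrals against test functions. -/
theorem eq_zero_of_forall_test {b : ℕ} {F : AxialL2 (2 * b + 2)}
    (hF : ∀ ψ, IsTest ψ → ∫ x in Ioo (-1 : ℝ) 1, F x * ψ x = 0) : F = 0 := by
  have hae := isOpen_Ioo.ae_eq_zero_of_integral_contDiff_smul_eq_zero (U := Ioo (-1 : ℝ) 1)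
    (μ := axialMeasure (2 * b + 2)) (f := F)
    ((integrable_axialL2 F).locallyIntegrable.locallyIntegrableOn _) fun g hg hc hs => ?_
  · refine Lp.ext ?_
    filter_upwards [hae, ae_mem_axialMeasure (2 * b + 2), Lp.coeFn_zero ℝ 2 (axialMeasure _)]
      with x h1 h2 h3
    rw [h1 h2, h3, Pi.zero_apply]
  -- The factor `(1 - x²)^b` turns Lebesgue measure into `axialMeasure`.
  · have h := hF _ ((IsTest.mk hg hc hs).smooth_mul (f := fun x => (1 - x ^ 2) ^ b) (by fun_prop))
    rw [integral_axialMeasure, ← h]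
    refine integral_congr_ae (Filter.Eventually.of_forall fun x => ?_)
    have : (((2 * b + 2 - 2 : ℕ) : ℝ) / 2) = (b : ℝ) := by
      rw [Nat.add_sub_cancel]; push_cast; ring
    simp only [this, Real.rpow_natCast, smul_eq_mul]
    ring

/-- The distributional equation says that `P_n u - ρ • rightSide hn u`, an element of `L²`, integrates
to zero against all test functions. -/
theorem isSolution_iff_solvesODE {n : ℕ} (hn : 2 ≤ n) (he : Even n) (ρ : ℝ)
    (v : axialSobolev n) : IsSolution n ρ v ↔ SolvesODE n ρ v := by
  obtain ⟨b, rfl⟩ : ∃ b, n = 2 * b + 2 := by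
    obtain ⟨c, hc⟩ := he
    exact ⟨c - 1, by omega⟩
  obtain ⟨f, hf⟩ := exists_paneitz hn v
  set F : AxialL2 (2 * b + 2) := f - ρ • rightSide hn v with hFdef
  have hweak : ∀ ψ, IsTest ψ → (-1 : ℝ) ^ ((2 * b + 2) / 2) * (∫ x in Ioo (-1 : ℝ) 1,
        toFn v x * deriv (fun y => (1 - y ^ 2) ^ ((2 * b + 2) / 2) *
          iteratedDeriv (2 * b + 2 - 1) ψ y) x)
      + ρ * (∫ x in Ioo (-1 : ℝ) 1, (1 - sphereConst (2 * b + 2) *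
          (Real.exp ((2 * b + 2 : ℕ) * toFn v x) /
            ∫ y, Real.exp ((2 * b + 2 : ℕ) * toFn v y) ∂(axialMeasure (2 * b + 2)))) * ψ x) =
      ∫ x in Ioo (-1 : ℝ) 1, F x * ψ x := by
    intro ψ hψ
    have e1 : (2 * b + 2) / 2 = b + 1 := by omega
    have e2 : 2 * b + 2 - 1 = 2 * b + 1 := by omega
    rw [e1, e2]
    have hD := ((hψ.iteratedDeriv (2 * b + 1)).smooth_mul (f := fun y => (1 - y ^ 2) ^ (b + 1))
      (by fun_prop)).deriv
    obtain ⟨g, hg⟩ := hψ.exists_dual (2 * b + 2)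
    obtain ⟨d, hd⟩ := hD.exists_dual (2 * b + 2)
    have inner_eq : ∀ a c : AxialL2 (2 * b + 2),
        inner ℝ a c = ∫ x, c x * a x ∂(axialMeasure (2 * b + 2)) := fun a c => by
      rw [L2.inner_def]
      rfl
    have hgd : IsPaneitz (2 * b + 2) g ((-1 : ℝ) ^ (b + 1) • d) := by
      rw [isPaneitz_iff hn]
      intro k
      rw [map_smul, lp.coeFn_smul, Pi.smul_apply, smul_eq_mul, repr_gegenbauerBasis,
        repr_gegenbauerBasis]
      simp only [mul_comm _ ((sphereGegenbauer (2 * b + 2) k).eval _), hg, hd]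
      simp only [mul_comm ((sphereGegenbauer (2 * b + 2) k).eval _), hψ.integral_adjoint_mul]
      have : (-1 : ℝ) ^ (b + 1) * (-1) ^ (b + 1) = 1 := by rw [← mul_pow]; norm_num
      linear_combination (√(gegenbauerNormSq (2 * b + 2) k))⁻¹ * eigenvalue (2 * b + 2) k *
        (∫ x in Ioo (-1 : ℝ) 1, ψ x * (sphereGegenbauer (2 * b + 2) k).eval x) * this
    have hsymm := inner_paneitz hn hf hgd
    rw [real_inner_smul_left, inner_eq, hd, inner_eq, hg] at hsymm
    have hR : ∫ x in Ioo (-1 : ℝ) 1, (1 - sphereConst (2 * b + 2) *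
          (Real.exp ((2 * b + 2 : ℕ) * toFn v x) /
            ∫ y, Real.exp ((2 * b + 2 : ℕ) * toFn v y) ∂(axialMeasure (2 * b + 2)))) * ψ x =
        -inner ℝ g (rightSide hn v) := by
      rw [← hg, inner_eq, ← integral_neg]
      refine integral_congr_ae ?_
      filter_upwards [rightSide_ae_eq hn v] with x hx
      rw [hx]
      ring
    rw [hR, hsymm, ← hg, ← hg, ← inner_eq, ← inner_eq, hFdef, inner_sub_right,
      real_inner_smul_right]
    ring
  have hsol : IsSolution (2 * b + 2) ρ v ↔ F = 0 := by
    rw [isSolution_iff_isPaneitz hn, hFdef, sub_eq_zero]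
    refine ⟨fun h => gegenbauerBasis_ext hn fun k => ?_, fun h => h ▸ hf⟩
    rw [(isPaneitz_iff hn _ _).1 hf k, (isPaneitz_iff hn _ _).1 h k]
  rw [hsol]
  constructor
  · intro h ψ h1 h2 h3
    rw [hweak ψ ⟨h1, h2, h3⟩, h]
    obtain ⟨g, hg⟩ := (IsTest.mk h1 h2 h3).exists_dual (2 * b + 2)
    rw [← hg]
    refine integral_eq_zero_of_ae ?_
    filter_upwards [Lp.coeFn_zero ℝ 2 (axialMeasure (2 * b + 2))] with x hx
    rw [hx]
    simp
  · intro h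
    exact eq_zero_of_forall_test fun ψ hψ => by
      rw [← hweak ψ hψ]
      exact h ψ hψ.1 hψ.2 hψ.3

end AxialPaneitz

theorem theorem4p3 (n : ℕ) (hn : 2 ≤ n) :
    -- for even `n`, the Paneitz equation in `𝒱` is the ordinary differential equation
    (Even n → ∀ (ρ : ℝ) (u : AxialPaneitz.axialSobolev n),
      AxialPaneitz.IsSolution n ρ u ↔ AxialPaneitz.SolvesODE n ρ u) ∧
    (∀ ρ : ℝ, AxialPaneitz.IsSolution n ρ 0) ∧
    ∀ k : ℕ, 1 ≤ k →
      AxialPaneitz.IsBifurcationPoint n (AxialPaneitz.bifValue n k) ∧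
      ∃ w : AxialPaneitz.axialSobolev n,
        (∀ᵐ x ∂(AxialPaneitz.axialMeasure n),
          AxialPaneitz.toFn w x = (AxialPaneitz.sphereGegenbauer n k).eval x) ∧
        ∃ (ε₀ : ℝ) (r : ℝ → ℝ) (ψ : ℝ → AxialPaneitz.axialSobolev n),
          AxialPaneitz.IsLocalBranch n k w ε₀ r ψ ∧
          (k = 2 →
            AxialPaneitz.bifValue n 2 = ((n + 1).factorial : ℝ) / n ∧
            AxialPaneitz.IsTranscritical r ∧
            HasDerivAt r
              (-(((n + 1).factorial : ℝ) / 2) *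
                ((∫ x, (AxialPaneitz.sphereGegenbauer n 2).eval x ^ 3
                    ∂(AxialPaneitz.axialMeasure n)) /
                  (∫ x, (AxialPaneitz.sphereGegenbauer n 2).eval x ^ 2
                    ∂(AxialPaneitz.axialMeasure n)))) 0 ∧
            deriv r 0 = -(((n + 1).factorial : ℝ) * ((n : ℝ) - 1) ^ 2 / ((n : ℝ) + 5)) ∧
            deriv r 0 ≠ 0) := by


  refine ⟨fun he ρ u => AxialPaneitz.isSolution_iff_solvesODE hn he ρ u,
    AxialPaneitz.isSolution_zero hn, fun k hk => ?_⟩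
  obtain ⟨w, hw⟩ := AxialPaneitz.exists_gegenbauer_mem hn hk
  obtain ⟨ε₀, r, ψ, hb, hd⟩ := AxialPaneitz.exists_localBranch hn hk hw
  refine ⟨AxialPaneitz.isBifurcationPoint hn hb, w, ?_, ε₀, r, ψ, hb, ?_⟩
  · rw [hw]
    exact AxialPaneitz.coeFn_polyL2 n _
  rintro rfl
  have hn' : (2 : ℝ) ≤ n := by exact_mod_cast hn
  have hval := AxialPaneitz.gegenbauer_two_integrals hn
  have hint : ∀ m : ℕ, ∫ x, (AxialPaneitz.sphereGegenbauer n 2).eval x ^ m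
      ∂(AxialPaneitz.axialMeasure n) =
        AxialPaneitz.polyIntegral n (AxialPaneitz.sphereGegenbauer n 2 ^ m) := fun m => by
    rw [AxialPaneitz.polyIntegral_apply]
    simp only [eval_pow]
  rw [AxialPaneitz.eigenvalue_two] at hd
  have hfac : ((n + 1).factorial : ℝ) ≠ 0 := Nat.cast_ne_zero.2 (Nat.factorial_ne_zero _)
  have hderiv : deriv r 0 = -(((n + 1).factorial : ℝ) * ((n : ℝ) - 1) ^ 2 / ((n : ℝ) + 5)) := by
    rw [hd.deriv, hval]
    ring
  have hne : deriv r 0 ≠ 0 := by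
    rw [hderiv]
    have : (n : ℝ) - 1 ≠ 0 := by linarith
    exact neg_ne_zero.2 (div_ne_zero (mul_ne_zero hfac (pow_ne_zero 2 this)) (by positivity))
  refine ⟨by rw [AxialPaneitz.bifValue, AxialPaneitz.eigenvalue_two],
    AxialPaneitz.isTranscritical_of_hasDerivAt hd (hd.deriv ▸ hne), ?_, hderiv, hne⟩
  rw [hint, hint]
  exact hd
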